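/- Let $0<q<1$, let $j\ge 1$ be an integer, $N=2j$, and let $a,c,\alpha$ be real numbers with $a,c\neq 0$. Write $(z;q)_n=\prod_{i=0}^{n-1}(1-zq^i)$ and $(z_1,\dots,z_k;q)_n=\prod_i (z_i;q)_n$. Let $R_n(x)=R_n(x;a,c,\alpha|q)$ be the monic $q$-para-Racah polynomials defined by $R_{-1}=0$, $R_0=1$, $xR_n=R_{n+1}+b_nR_n+u_nR_{n-1}$, where $$b_n=\frac{a+a^{-1}}2+\frac{(q^n-1)(acq^{2j}-q^n)(aq^{j+1}-cq^n)}{2ac(q^j+q^n)(q^{2j+1}-q^{2n})}+\frac{(q^{2j}-q^n)(acq^n-1)(cq^j-aq^{n+1})}{2ac(q^j+q^n)(q^{2j}-q^{2n+1})},$$ $$u_n=\frac{(q^n-1)(q^n-q^{2j+1})(acq^n-q)(q^n-acq^{2j})(aq^n-cq^j)(cq^n-aq^{j+1})}{4a^2c^2(q^j+q^n)(q^{j+1}+q^n)(q^{2j+1}-q^{2n})^2}\quad(n\ne j,j+1),$$ $$u_j=(1-\alpha)\mu,\quad u_{j+1}=\alpha\mu,\quad \mu=\frac{(c-a)q^{-2j}(q^j-1)(q^{j+1}-1)(aq-c)(acq^j-1)(acq^j-q)}{4a^2c^2(q-1)^2(q+1)}.$$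 (1) These coefficients come from a singular truncation of the Askey-Wilson polynomials. Let $$A_n=\frac{(1-abq^n)(1-acq^n)(1-adq^n)(1-abcdq^{n-1})}{a(1-abcdq^{2n-1})(1-abcdq^{2n})},\quad C_n=\frac{a(1-q^n)(1-bcq^{n-1})(1-bdq^{n-1})(1-cdq^{n-1})}{(1-abcdq^{2n-2})(1-abcdq^{2n-1})}$$ with $b=a^{-1}q^{-j+e_1t}$, $d=c^{-1}q^{-j+1+e_2t}$, where $e_1,e_2\in\mathbb R$, $e_1+e_2\ne0$, $e_1/(e_1+e_2)=\alpha$. Then $b_n=\lim_{t\to0}\tfrac12(a+a^{-1}-A_n-C_n)$ for $0\le n\le N$ and $u_n=\lim_{t\to0}\tfrac14A_{n-1}C_n$ for $1\le n\le N$. (2) There is a constant $\kappa\neq0$ such that for all $\theta\in\mathbb C$, with $x=\cos\theta$, $$R_{N+1}(x)=\kappa\,(ae^{i\theta},ae^{-i\theta};q)_{j+1}\,(ce^{i\theta},ce^{-i\theta};q)_j .$$ The real zeros of $R_{N+1}$ are exactly the points of the bi-lattice $$x_{2s}=\tfrac12(a^{-1}q^{-s}+aq^s)\ (0\le s\le j),\qquad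 x_{2s+1}=\tfrac12(c^{-1}q^{-s}+cq^s)\ (0\le s\le j-1).$$ (3) If the points $x_0,\dots,x_N$ are pairwise distinct, then $$\sum_{s=0}^N w_sR_n(x_s)R_m(x_s)=u_1u_2\cdots u_n\,\delta_{nm}\quad(0\le n,m\le N),\qquad \sum_{s=0}^{j}w_{2s}=1-\alpha,\qquad \sum_{s=0}^{j-1}w_{2s+1}=\alpha,$$ where $$w_{2s}=\frac{(1-\alpha)K_Na^jc^jq^{2js}(1-a^2q^{2s})(a^2;q)_s(q^{-j};q)_s(ac;q)_s(\frac{aq^{1-j}}c;q)_s}{(q;q)_j(a^2q;q)_j(\frac ca;q)_j(ac;q)_j(1-a^2)(q;q)_s(\frac{aq}c;q)_s(a^2q^{j+1};q)_s(acq^j;q)_s},$$ $$w_{2s+1}=\frac{-\alpha K_Na^{j+1}c^{j-1}q^{2js}(1-c^2q^{2s})(c^2;q)_s(q^{1-j};q)_s(ac;q)_s(\frac{cq^{-j}}a;q)_s}{(q;q)_{j-1}(c^2q;q)_{j-1}(\frac ac;q)_{j+1}(ac;q)_{j+1}(1-c^2)(q;q)_s(\frac{cq}a;q)_s(c^2q^j;q)_s(acq^{j+1};q)_s},$$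 $$K_N=\frac{q^{2j^2+1}(c-a)(1+q^j)(1-q^{j+1})(1-q^{2j+1})(c-aq)(q;q)_j(q^{-2j-1};q)_j(\frac{ac}q;q)_{j+2}(\frac{cq^{-j-1}}a;q)_j(\frac{q^{-2j}}{ac};q)_j(\frac{aq^{-j}}c;q)_j}{(1-q)^2(ac-q)(q^{-2j-1};q^2)_j^2(-q;q)_j^2(a-cq^j)(1-acq^{2j})(c-aq^{j+1})}.$$ Here removable $0/0$ factors are cancelled: $\frac{(1-a^2q^{2s})(a^2;q)_s}{(1-a^2)(a^2q;q)_j(a^2q^{j+1};q)_s}$ is read as $\prod_{0\le r\le j,\,r\ne s}(1-a^2q^{s+r})^{-1}$, the factor $\frac{(1-c^2q^{2s})(c^2;q)_s}{(1-c^2)(c^2q;q)_{j-1}(c^2q^j;q)_s}$ as $\prod_{0\le r\le j-1,\,r\ne s}(1-c^2q^{s+r})^{-1}$, and in $K_N$ each of the denominator factors $ac-q$, $a-cq^j$, $1-acq^{2j}$, $c-aq^{j+1}$ is cancelled against the corresponding first factor of $(\frac{ac}q;q)_{j+2}$, $(\frac{aq^{-j}}c;q)_j$, $(\frac{q^{-2j}}{ac};q)_j$,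 $(\frac{cq^{-j-1}}a;q)_j$. (4) If $u_n>0$ for $n=1,\dots,N$, then $x_0,\dots,x_N$ are pairwise distinct and $w_s>0$ for $0\le s\le N$, so that the $R_n$ are orthogonal with respect to a positive measure. -/

import Mathlib

open Finset Filter Topology Polynomial

namespace QParaRacah

/-- The `q`-Pochhammer symbol `(z;q)_n = (1 - z)(1 - zq)⋯(1 - zq^{n-1})`. -/
def qPoch {K : Type*} [CommRing K] (z q : K) (n : ℕ) : K :=
  ∏ i ∈ range n, (1 - z * q ^ i)

/-- Askey-Wilson recurrence coefficient `A_n` with parameters `a, b, c, d`. -/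
noncomputable def awA (q a b c d : ℝ) (n : ℤ) : ℝ :=
  (1 - a * b * q ^ n) * (1 - a * c * q ^ n) * (1 - a * d * q ^ n)
      * (1 - a * b * c * d * q ^ (n - 1)) /
    (a * (1 - a * b * c * d * q ^ (2 * n - 1)) * (1 - a * b * c * d * q ^ (2 * n)))

/-- Askey-Wilson recurrence coefficient `C_n` with parameters `a, b, c, d`. -/
noncomputable def awC (q a b c d : ℝ) (n : ℤ) : ℝ :=
  a * (1 - q ^ n) * (1 - b * c * q ^ (n - 1)) * (1 - b * d * q ^ (n - 1))
      * (1 - c * d * q ^ (n - 1)) /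
    ((1 - a * b * c * d * q ^ (2 * n - 2)) * (1 - a * b * c * d * q ^ (2 * n - 1)))

/-- The singular parametrization of `b`: `b(t) = a⁻¹ q^{-j + e₁ t}`. -/
noncomputable def bPar (q a e₁ : ℝ) (j : ℕ) (t : ℝ) : ℝ :=
  a⁻¹ * q ^ (-(j : ℝ) + e₁ * t)

/-- The singular parametrization of `d` for `N = 2j`: `d(t) = c⁻¹ q^{-j + 1 + e₂ t}`. -/
noncomputable def dPar (q c e₂ : ℝ) (j : ℕ) (t : ℝ) : ℝ :=
  c⁻¹ * q ^ (-(j : ℝ) + 1 + e₂ * t)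

/-- The recurrence coefficient `b_n` of the `q`-para-Racah polynomials for `N = 2j`. -/
noncomputable def bCoef (q a c : ℝ) (j n : ℕ) : ℝ :=
  (a + a⁻¹) / 2
    + (q ^ n - 1) * (a * c * q ^ (2 * j) - q ^ n) * (a * q ^ (j + 1) - c * q ^ n) /
        (2 * a * c * (q ^ j + q ^ n) * (q ^ (2 * j + 1) - q ^ (2 * n)))
    + (q ^ (2 * j) - q ^ n) * (a * c * q ^ n - 1) * (c * q ^ j - a * q ^ (n + 1)) /
        (2 * a * c * (q ^ j + q ^ n) * (q ^ (2 * j) - q ^ (2 * n + 1)))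

/-- The part of `u_j` and `u_{j+1}` that does not depend on `α`. -/
noncomputable def uMid (q a c : ℝ) (j : ℕ) : ℝ :=
  (c - a) * q ^ (-(2 * j : ℤ)) * (q ^ j - 1) * (q ^ (j + 1) - 1) * (a * q - c)
      * (a * c * q ^ j - 1) * (a * c * q ^ j - q) /
    (4 * a ^ 2 * c ^ 2 * (q - 1) ^ 2 * (q + 1))

/-- The recurrence coefficient `u_n` of the `q`-para-Racah polynomials for `N = 2j`. -/
noncomputable def uCoef (q a c α : ℝ) (j n : ℕ) : ℝ :=
  if n = j then (1 - α) * uMid q a c j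
  else if n = j + 1 then α * uMid q a c j
  else
    (q ^ n - 1) * (q ^ n - q ^ (2 * j + 1)) * (a * c * q ^ n - q) * (q ^ n - a * c * q ^ (2 * j))
        * (a * q ^ n - c * q ^ j) * (c * q ^ n - a * q ^ (j + 1)) /
      (4 * a ^ 2 * c ^ 2 * (q ^ j + q ^ n) * (q ^ (j + 1) + q ^ n)
        * (q ^ (2 * j + 1) - q ^ (2 * n)) ^ 2)

/-- The monic `q`-para-Racah polynomials `R_n(x; a, c, α | q)` for `N = 2j`, defined by
`x R_n = R_{n+1} + b_n R_n + u_n R_{n-1}`, `R_{-1} = 0`, `R_0 = 1`. -/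
noncomputable def R (q a c α : ℝ) (j : ℕ) : ℕ → ℝ[X]
  | 0 => 1
  | 1 => X - C (bCoef q a c j 0)
  | n + 2 => (X - C (bCoef q a c j (n + 1))) * R q a c α j (n + 1)
      - C (uCoef q a c α j (n + 1)) * R q a c α j n

/-- The exponential-type lattice `(z⁻¹ q^{-s} + z q^s) / 2`. -/
noncomputable def lattice (q z : ℝ) (s : ℕ) : ℝ :=
  (z⁻¹ * q ^ (-(s : ℤ)) + z * q ^ s) / 2

/-- The bi-lattice: `node (2s) = lattice a s` and `node (2s+1) = lattice c s`. -/
noncomputable def node (q a c : ℝ) (s : ℕ) : ℝ :=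
  if Even s then lattice q a (s / 2) else lattice q c (s / 2)

/-- The constant `K_N` for `N = 2j`, with the factors cancelled that occur both in numerator and
denominator of its usual form; see `KConst_eq`. Meant for `1 ≤ j`. -/
noncomputable def KConst (q a c : ℝ) (j : ℕ) : ℝ :=
  q ^ (2 * (j : ℤ) ^ 2 - 4 * j - 1) * (c - a) * (1 + q ^ j) * (1 - q ^ (j + 1))
      * (1 - q ^ (2 * j + 1)) * (c - a * q) * qPoch q q j * qPoch (q ^ (-(2 * j : ℤ) - 1)) q j
      * qPoch (a * c) q (j + 1) * qPoch (c * q ^ (-(j : ℤ)) / a) q (j - 1)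
      * qPoch (q ^ (1 - 2 * (j : ℤ)) / (a * c)) q (j - 1)
      * qPoch (a * q ^ (1 - (j : ℤ)) / c) q (j - 1) /
    (a ^ 2 * c ^ 2 * (1 - q) ^ 2 * qPoch (q ^ (-(2 * j : ℤ) - 1)) (q ^ 2) j ^ 2
      * qPoch (-q) q j ^ 2)

/-- `∏_{0 ≤ r ≤ m, r ≠ s} (1 - z q^{s+r})`; see `selfProd_eq`. -/
noncomputable def selfProd (q z : ℝ) (m s : ℕ) : ℝ :=
  ∏ r ∈ (range (m + 1)).erase s, (1 - z * q ^ (s + r))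

/-- The weight `w_{2s}`, `0 ≤ s ≤ j`; see `weightEven_eq` for its form in terms of `q`-Pochhammer
symbols only. -/
noncomputable def weightEven (q a c α : ℝ) (j s : ℕ) : ℝ :=
  (1 - α) * KConst q a c j * a ^ j * c ^ j * q ^ (2 * j * s)
      * qPoch (q ^ (-(j : ℤ))) q s * qPoch (a * c) q s * qPoch (a * q ^ (1 - (j : ℤ)) / c) q s /
    (qPoch q q j * qPoch (c / a) q j * qPoch (a * c) q j * selfProd q (a ^ 2) j s
      * qPoch q q s * qPoch (a * q / c) q s * qPoch (a * c * q ^ j) q s)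

/-- The weight `w_{2s+1}`, `0 ≤ s ≤ j - 1`, where `1 ≤ j`; see `weightOdd_eq`. -/
noncomputable def weightOdd (q a c α : ℝ) (j s : ℕ) : ℝ :=
  -(α * KConst q a c j * a ^ (j + 1) * c ^ (j - 1) * q ^ (2 * j * s)
      * qPoch (q ^ (1 - (j : ℤ))) q s * qPoch (a * c) q s * qPoch (c * q ^ (-(j : ℤ)) / a) q s) /
    (qPoch q q (j - 1) * qPoch (a / c) q (j + 1) * qPoch (a * c) q (j + 1)
      * selfProd q (c ^ 2) (j - 1) s
      * qPoch q q s * qPoch (c * q / a) q s * qPoch (a * c * q ^ (j + 1)) q s)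

/-- The weights on the bi-lattice: `weight (2s) = w_{2s}` and `weight (2s+1) = w_{2s+1}`. -/
noncomputable def weight (q a c α : ℝ) (j s : ℕ) : ℝ :=
  if Even s then weightEven q a c α j (s / 2) else weightOdd q a c α j (s / 2)

/-! Agreement of the cancelled forms above with the usual ones. -/

theorem qPoch_succ_left {K : Type*} [CommRing K] (z q : K) (n : ℕ) :
    qPoch z q (n + 1) = (1 - z) * qPoch (z * q) q n := by
  unfold qPoch
  rw [prod_range_succ']
  simp only [pow_zero, mul_one]
  rw [mul_comm]
  congr 1
  exact prod_congr rfl fun i _ => by ring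

theorem qPoch_add {K : Type*} [CommRing K] (z q : K) (m n : ℕ) :
    qPoch z q (m + n) = qPoch z q m * qPoch (z * q ^ m) q n := by
  unfold qPoch
  rw [prod_range_add]
  congr 1
  exact prod_congr rfl fun i _ => by ring

theorem selfProd_eq (q z : ℝ) (m s : ℕ) (hs : s ≤ m) (h0 : 1 - z ≠ 0)
    (h1 : qPoch (z * q) q m ≠ 0) (h2 : qPoch (z * q ^ (m + 1)) q s ≠ 0) :
    1 / selfProd q z m s = (1 - z * q ^ (2 * s)) * qPoch z q s /
      (qPoch (z * q) q m * (1 - z) * qPoch (z * q ^ (m + 1)) q s) := by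
  have key : (1 - z * q ^ (2 * s)) * selfProd q z m s = qPoch (z * q ^ s) q (m + 1) := by
    unfold selfProd qPoch
    rw [← mul_prod_erase (range (m + 1)) _ (mem_range.2 (Nat.lt_succ_of_le hs))]
    congr 1
    · ring
    · exact prod_congr rfl fun i _ => by ring
  have e1 : qPoch z q (m + 1 + s) =
      qPoch (z * q) q m * (1 - z) * qPoch (z * q ^ (m + 1)) q s := by
    rw [qPoch_add, qPoch_succ_left]; ring
  have e2 : qPoch z q (m + 1 + s) =
      qPoch z q s * ((1 - z * q ^ (2 * s)) * selfProd q z m s) := by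
    rw [key, add_comm (m + 1) s, qPoch_add]
  have hne : qPoch z q (m + 1 + s) ≠ 0 := by
    rw [e1]; exact mul_ne_zero (mul_ne_zero h1 h0) h2
  have hS : selfProd q z m s ≠ 0 := by
    intro h; apply hne; rw [e2, h]; ring
  rw [← e1, div_eq_div_iff hS hne, e2]
  ring

/-- The usual form of `w_{2s}`, valid whenever its denominator does not vanish. -/
theorem weightEven_eq (q a c α : ℝ) (j s : ℕ) (hs : s ≤ j) (h0 : 1 - a ^ 2 ≠ 0)
    (h1 : qPoch (a ^ 2 * q) q j ≠ 0) (h2 : qPoch (a ^ 2 * q ^ (j + 1)) q s ≠ 0) :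
    weightEven q a c α j s =
      (1 - α) * KConst q a c j * a ^ j * c ^ j * q ^ (2 * j * s) * (1 - a ^ 2 * q ^ (2 * s))
          * qPoch (a ^ 2) q s * qPoch (q ^ (-(j : ℤ))) q s * qPoch (a * c) q s
          * qPoch (a * q ^ (1 - (j : ℤ)) / c) q s /
        (qPoch q q j * qPoch (a ^ 2 * q) q j * qPoch (c / a) q j * qPoch (a * c) q j
          * (1 - a ^ 2) * qPoch q q s * qPoch (a * q / c) q s
          * qPoch (a ^ 2 * q ^ (j + 1)) q s * qPoch (a * c * q ^ j) q s) := by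
  have h := selfProd_eq q (a ^ 2) j s hs h0 h1 h2
  unfold weightEven
  generalize KConst q a c j = K at *
  calc _ = (1 / selfProd q (a ^ 2) j s) * ((1 - α) * K * a ^ j * c ^ j * q ^ (2 * j * s)
      * qPoch (q ^ (-(j : ℤ))) q s * qPoch (a * c) q s * qPoch (a * q ^ (1 - (j : ℤ)) / c) q s /
    (qPoch q q j * qPoch (c / a) q j * qPoch (a * c) q j
      * qPoch q q s * qPoch (a * q / c) q s * qPoch (a * c * q ^ j) q s)) := by
        rw [div_mul_div_comm]; congr 1 <;> ring
    _ = _ := by rw [h, div_mul_div_comm]; congr 1 <;> ring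

/-- The usual form of `w_{2s+1}`, valid whenever its denominator does not vanish. -/
theorem weightOdd_eq (q a c α : ℝ) (j s : ℕ) (hs : s ≤ j - 1) (hj : 1 ≤ j) (h0 : 1 - c ^ 2 ≠ 0)
    (h1 : qPoch (c ^ 2 * q) q (j - 1) ≠ 0) (h2 : qPoch (c ^ 2 * q ^ j) q s ≠ 0) :
    weightOdd q a c α j s =
      -(α * KConst q a c j * a ^ (j + 1) * c ^ (j - 1) * q ^ (2 * j * s)
          * (1 - c ^ 2 * q ^ (2 * s)) * qPoch (c ^ 2) q s * qPoch (q ^ (1 - (j : ℤ))) q s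
          * qPoch (a * c) q s * qPoch (c * q ^ (-(j : ℤ)) / a) q s) /
        (qPoch q q (j - 1) * qPoch (c ^ 2 * q) q (j - 1) * qPoch (a / c) q (j + 1)
          * qPoch (a * c) q (j + 1) * (1 - c ^ 2) * qPoch q q s * qPoch (c * q / a) q s
          * qPoch (c ^ 2 * q ^ j) q s * qPoch (a * c * q ^ (j + 1)) q s) := by
  have hj' : j - 1 + 1 = j := Nat.sub_add_cancel hj
  have h := selfProd_eq q (c ^ 2) (j - 1) s hs h0 h1 (by rw [hj']; exact h2)
  rw [hj'] at h
  unfold weightOdd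
  generalize KConst q a c j = K at *
  calc _ = (1 / selfProd q (c ^ 2) (j - 1) s) *
      (-(α * K * a ^ (j + 1) * c ^ (j - 1) * q ^ (2 * j * s)
      * qPoch (q ^ (1 - (j : ℤ))) q s * qPoch (a * c) q s * qPoch (c * q ^ (-(j : ℤ)) / a) q s) /
    (qPoch q q (j - 1) * qPoch (a / c) q (j + 1) * qPoch (a * c) q (j + 1)
      * qPoch q q s * qPoch (c * q / a) q s * qPoch (a * c * q ^ (j + 1)) q s)) := by
        rw [div_mul_div_comm]; congr 1 <;> ring
    _ = _ := by rw [h, div_mul_div_comm]; congr 1 <;> ring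

/-- The usual form of `K_N`, valid whenever its denominator does not vanish. -/
theorem KConst_eq (q a c : ℝ) (j : ℕ) (hj : 1 ≤ j) (hq : q ≠ 0) (ha : a ≠ 0) (hc : c ≠ 0)
    (h1 : a * c - q ≠ 0) (h2 : a - c * q ^ j ≠ 0) (h3 : 1 - a * c * q ^ (2 * j) ≠ 0)
    (h4 : c - a * q ^ (j + 1) ≠ 0) :
    KConst q a c j =
      q ^ (2 * j ^ 2 + 1) * (c - a) * (1 + q ^ j) * (1 - q ^ (j + 1)) * (1 - q ^ (2 * j + 1))
          * (c - a * q) * qPoch q q j * qPoch (q ^ (-(2 * j : ℤ) - 1)) q j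
          * qPoch (a * c / q) q (j + 2) * qPoch (c * q ^ (-(j : ℤ) - 1) / a) q j
          * qPoch (q ^ (-(2 * j : ℤ)) / (a * c)) q j * qPoch (a * q ^ (-(j : ℤ)) / c) q j /
        ((1 - q) ^ 2 * (a * c - q) * qPoch (q ^ (-(2 * j : ℤ) - 1)) (q ^ 2) j ^ 2
          * qPoch (-q) q j ^ 2 * (a - c * q ^ j) * (1 - a * c * q ^ (2 * j))
          * (c - a * q ^ (j + 1))) := by
  obtain ⟨k, rfl⟩ : ∃ k, j = k + 1 := ⟨j - 1, by omega⟩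
  have e1 : qPoch (a * c / q) q (k + 1 + 2) =
      (1 - a * c / q) * qPoch (a * c) q (k + 1 + 1) := by
    rw [qPoch_succ_left]; congr 2; field_simp
  have e2 : qPoch (c * q ^ (-((k + 1 : ℕ) : ℤ) - 1) / a) q (k + 1) =
      (1 - c / (a * q ^ (k + 2))) * qPoch (c * q ^ (-((k + 1 : ℕ) : ℤ)) / a) q k := by
    rw [qPoch_succ_left]
    congr 2
    · rw [show (-((k + 1 : ℕ) : ℤ) - 1) = -((k + 2 : ℕ) : ℤ) by push_cast; ring, zpow_neg,
        zpow_natCast]; field_simp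
    · rw [zpow_sub_one₀ hq]; field_simp
  have e3 : qPoch (q ^ (-(2 * (k + 1 : ℕ) : ℤ)) / (a * c)) q (k + 1) =
      (1 - 1 / (a * c * q ^ (2 * (k + 1)))) *
        qPoch (q ^ (1 - 2 * ((k + 1 : ℕ) : ℤ)) / (a * c)) q k := by
    rw [qPoch_succ_left]
    congr 2
    · rw [show (-(2 * (k + 1 : ℕ) : ℤ)) = -((2 * (k + 1) : ℕ) : ℤ) by push_cast; ring, zpow_neg,
        zpow_natCast]; field_simp
    · rw [sub_eq_add_neg (1 : ℤ), add_comm (1 : ℤ), zpow_add_one₀ hq]; field_simp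
  have e4 : qPoch (a * q ^ (-((k + 1 : ℕ) : ℤ)) / c) q (k + 1) =
      (1 - a / (c * q ^ (k + 1))) * qPoch (a * q ^ (1 - ((k + 1 : ℕ) : ℤ)) / c) q k := by
    rw [qPoch_succ_left]
    congr 2
    · rw [zpow_neg, zpow_natCast]; field_simp
    · rw [sub_eq_add_neg (1 : ℤ), add_comm (1 : ℤ), zpow_add_one₀ hq]; field_simp
  have e5 : q ^ (2 * ((k + 1 : ℕ) : ℤ) ^ 2 - 4 * ((k + 1 : ℕ) : ℤ) - 1) =
      q ^ (2 * (k + 1) ^ 2 + 1) / q ^ (4 * (k + 1) + 2) := by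
    rw [← zpow_natCast q (2 * (k + 1) ^ 2 + 1), ← zpow_natCast q (4 * (k + 1) + 2),
      ← zpow_sub₀ hq]
    congr 1; push_cast; ring
  have c1 : 1 - a * c / q = -(a * c - q) / q := by field_simp; ring
  have c2 : 1 - c / (a * q ^ (k + 2)) = -(c - a * q ^ (k + 1 + 1)) / (a * q ^ (k + 2)) := by
    field_simp; ring
  have c3 : 1 - 1 / (a * c * q ^ (2 * (k + 1))) =
      -(1 - a * c * q ^ (2 * (k + 1))) / (a * c * q ^ (2 * (k + 1))) := by
    field_simp; ring
  have c4 : 1 - a / (c * q ^ (k + 1)) = -(a - c * q ^ (k + 1)) / (c * q ^ (k + 1)) := by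
    field_simp; ring
  unfold KConst
  rw [e1, e2, e3, e4, e5, c1, c2, c3, c4]
  simp only [Nat.add_sub_cancel]
  have hcanc : ∀ (P D x1 x2 x3 x4 y1 y2 y3 y4 : ℝ), x1 ≠ 0 → x2 ≠ 0 → x3 ≠ 0 → x4 ≠ 0 →
      P * ((-x1 / y1) * (-x2 / y2) * (-x3 / y3) * (-x4 / y4)) / (D * (x1 * x2 * x3 * x4)) =
        P / (y1 * y2 * y3 * y4) / D := by
    intro P D x1 x2 x3 x4 y1 y2 y3 y4 g1 g2 g3 g4
    have : (-x1 / y1) * (-x2 / y2) * (-x3 / y3) * (-x4 / y4) =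
        (x1 * x2 * x3 * x4) * (1 / (y1 * y2 * y3 * y4)) := by
      simp only [div_eq_mul_inv, mul_inv]; ring
    rw [this, mul_comm D, mul_left_comm, mul_div_mul_left _ _ (by positivity), mul_one_div]
  symm
  set A1 := qPoch (q ^ (-(2 * (k + 1 : ℕ) : ℤ) - 1)) q (k + 1)
  set A2 := qPoch (q ^ (-(2 * (k + 1 : ℕ) : ℤ) - 1)) (q ^ 2) (k + 1)
  set A3 := qPoch (a * c) q (k + 1 + 1)
  set A4 := qPoch (c * q ^ (-((k + 1 : ℕ) : ℤ)) / a) q k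
  set A5 := qPoch (q ^ (1 - 2 * ((k + 1 : ℕ) : ℤ)) / (a * c)) q k
  set A6 := qPoch (a * q ^ (1 - ((k + 1 : ℕ) : ℤ)) / c) q k
  set A7 := qPoch q q (k + 1)
  set A8 := qPoch (-q) q (k + 1)
  have := hcanc (q ^ (2 * (k + 1) ^ 2 + 1) * (c - a) * (1 + q ^ (k + 1))
    * (1 - q ^ (k + 1 + 1)) * (1 - q ^ (2 * (k + 1) + 1)) * (c - a * q) * A7 * A1 * A3 * A4
    * A5 * A6) ((1 - q) ^ 2 * A2 ^ 2 * A8 ^ 2) _ _ _ _ q (a * q ^ (k + 2))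
    (a * c * q ^ (2 * (k + 1))) (c * q ^ (k + 1)) h1 h4 h3 h2
  calc _ = _ := by congr 1 <;> ring
    _ = _ := this
    _ = _ := by
      simp only [div_eq_mul_inv, mul_inv]
      ring

end QParaRacah

/-! The Askey-Wilson polynomials truncate in closed form. Replacing `a` by `aq` is a Christoffel
transformation at `(a + a⁻¹)/2`: the Jacobi matrix minus this point factors as LU, and the
coefficients at `aq` come from UL. If `ab = q^{-m}`, then `A_m = 0`, so one step splits off the
exact factor `X - (a + a⁻¹)/2` and lowers `m` by one. Hence the polynomial of degree `m + 1` has the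
zeros `lattice q a s`, `s ≤ m` (`aw_truncation`).

In the singular limit `1 - abq^n` (in `A_n`) or `1 - cdq^{n-1}` (in `C_n`) vanishes at `n = j`
together with `1 - abcdq^{2n-1}`. The two ratios tend to `α` and `1 - α`; this is the only way `α`
enters. Taking `e₁ = 0` keeps `ab = q^{-j}` for all `t`, so `P_{j+1}` at `α = 0` has the `a`-lattice
as zeros. Taking `e₂ = 0` keeps `cd = q^{1-j}`, so `P_j`, which does not see `α`, has the
`c`-lattice as zeros (`recPoly_alpha_zero`, `recPoly_half`).

Away from `u_j, u_{j+1}` the coefficients are mirror symmetric. Cutting the chain in the middle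
gives `P_{2j+1} = P_j (P_{j+1} - αμ P_{j-1})`, and the bracket is `P_{j+1}` at `α = 0`. So the
characteristic polynomial does not depend on `α` and its zeros form the bi-lattice (`recPoly_full`).

For orthogonality, mix the Gauss quadratures at the zeros of `P_{j+1}` (at `α = 0`) and of `P_j`
with masses `1 - α` and `α`. The two errors created by splitting `u_j` cancel, and the mixture
annihilates `P_1, …, P_N` (`recPoly_mixture`). Since the nodes are zeros of `P_{N+1}`, the
recurrence upgrades this to full orthogonality (`recPoly_orthogonal`). The partial sums of the
weights are the two masses. Only `u_1, …, u_j` of the chain at `α = 0` have to be nonzero, so `α`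
stays arbitrary. The explicit weights are identified with the Gauss weights by rearranging
`q`-products.

For positivity, the Wronskian of neighbouring polynomials is positive. At a repeated zero of
`P_{N+1}` it would vanish, and for the pair `P_{j+1}, P_j` at `α = 0` it fixes the sign of each
weight. -/

namespace QParaRacah

/-! ### Polynomials defined by a three-term recurrence -/

/-- The monic polynomials with `x P_n = P_{n+1} + b_n P_n + u_n P_{n-1}`, `P_0 = 1`. -/
noncomputable def recPoly (b u : ℕ → ℝ) : ℕ → ℝ[X]
  | 0 => 1
  | 1 => X - C (b 0)
  | n + 2 => (X - C (b (n + 1))) * recPoly b u (n + 1) - C (u (n + 1)) * recPoly b u n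

theorem recPoly_zero (b u : ℕ → ℝ) : recPoly b u 0 = 1 := rfl

theorem recPoly_one (b u : ℕ → ℝ) : recPoly b u 1 = X - C (b 0) := rfl

theorem recPoly_add_two (b u : ℕ → ℝ) (n : ℕ) : recPoly b u (n + 2) =
    (X - C (b (n + 1))) * recPoly b u (n + 1) - C (u (n + 1)) * recPoly b u n := rfl

theorem R_eq_recPoly (q a c α : ℝ) (j n : ℕ) :
    R q a c α j n = recPoly (bCoef q a c j) (uCoef q a c α j) n := by
  induction n using Nat.twoStepInduction with
  | zero => rfl
  | one => rfl
  | more n h1 h2 => rw [R, h1, h2, recPoly_add_two]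

theorem recPoly_congr {b u b' u' : ℕ → ℝ} {m : ℕ} (hb : ∀ n < m, b n = b' n)
    (hu : ∀ n, 1 ≤ n → n < m → u n = u' n) : recPoly b u m = recPoly b' u' m := by
  induction m using Nat.twoStepInduction with
  | zero => rfl
  | one => rw [recPoly_one, recPoly_one, hb 0 one_pos]
  | more m h1 h2 =>
    rw [recPoly_add_two, recPoly_add_two, hb _ (by omega), hu _ (by omega) (by omega),
      h1 (fun n hn => hb n (by omega)) (fun n hn hn' => hu n hn (by omega)),
      h2 (fun n hn => hb n (by omega)) (fun n hn hn' => hu n hn (by omega))]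

/-- Multiplication of `P_n` by `x`, evaluated at a point. -/
theorem recPoly_eval_mul (b u : ℕ → ℝ) (n : ℕ) (x : ℝ) :
    x * (recPoly b u (n + 1)).eval x = (recPoly b u (n + 2)).eval x
      + b (n + 1) * (recPoly b u (n + 1)).eval x + u (n + 1) * (recPoly b u n).eval x := by
  rw [recPoly_add_two]
  simp only [eval_sub, eval_mul, eval_X, eval_C]
  ring

theorem tendsto_recPoly_eval {ι : Type*} {l : Filter ι} {b u : ι → ℕ → ℝ} {b' u' : ℕ → ℝ} {m : ℕ}
    (hb : ∀ n < m, Tendsto (fun t => b t n) l (𝓝 (b' n)))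
    (hu : ∀ n, 1 ≤ n → n < m → Tendsto (fun t => u t n) l (𝓝 (u' n))) (x : ℝ) :
    Tendsto (fun t => (recPoly (b t) (u t) m).eval x) l (𝓝 ((recPoly b' u' m).eval x)) := by
  induction m using Nat.twoStepInduction with
  | zero => simp only [recPoly_zero, eval_one]; exact tendsto_const_nhds
  | one =>
    simp only [recPoly_one, eval_sub, eval_X, eval_C]
    exact tendsto_const_nhds.sub (hb 0 one_pos)
  | more m h1 h2 =>
    simp only [recPoly_add_two, eval_sub, eval_mul, eval_X, eval_C]
    exact ((tendsto_const_nhds.sub (hb _ (by omega))).mul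
      (h2 (fun n hn => hb n (by omega)) fun n hn hn' => hu n hn (by omega))).sub
      ((hu _ (by omega) (by omega)).mul
      (h1 (fun n hn => hb n (by omega)) fun n hn hn' => hu n hn (by omega)))

/-- The Christoffel transformation: removing a factor `X - y`. -/
theorem recPoly_christoffel {A B b u b' u' : ℕ → ℝ} {y : ℝ} (h0 : B 0 = 0)
    (hb : ∀ n, b n = y - A n - B n) (hu : ∀ n, u (n + 1) = A n * B (n + 1))
    (hb' : ∀ n, b' n = y - A n - B (n + 1)) (hu' : ∀ n, u' (n + 1) = A (n + 1) * B (n + 1))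
    (n : ℕ) :
    (X - C y) * recPoly b' u' n = recPoly b u (n + 1) - C (A n) * recPoly b u n ∧
    recPoly b u (n + 1) = recPoly b' u' (n + 1) - C (B (n + 1)) * recPoly b' u' n := by
  induction n with
  | zero =>
    simp only [zero_add, recPoly_zero, recPoly_one, hb, hb', h0, C_sub, C_0]
    constructor <;> ring
  | succ n ih =>
    obtain ⟨h1, h2⟩ := ih
    have e1 : (X - C y) * recPoly b' u' (n + 1) =
        recPoly b u (n + 2) - C (A (n + 1)) * recPoly b u (n + 1) := by
      rw [recPoly_add_two, hb, hu]
      simp only [C_sub, C_mul]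
      linear_combination -(X - C y) * h2 + C (B (n + 1)) * h1
    refine ⟨e1, ?_⟩
    rw [recPoly_add_two b' u', hb', hu']
    simp only [C_sub, C_mul]
    linear_combination -e1 + C (A (n + 1)) * h2

/-- Splitting a chain with mirror symmetric coefficients. -/
theorem recPoly_mirror {b u : ℕ → ℝ} {j : ℕ} (hb : ∀ n < j, b (2 * j - n) = b n)
    (hu : ∀ n, 1 ≤ n → n < j → u (2 * j + 1 - n) = u n) (k : ℕ) (hk : k + 1 ≤ j) :
    recPoly b u (2 * j + 1) = recPoly b u (2 * j - k) * recPoly b u (k + 1)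
      - C (u (2 * j - k)) * recPoly b u (2 * j - k - 1) * recPoly b u k := by
  induction k with
  | zero =>
    obtain ⟨i, rfl⟩ : ∃ i, j = i + 1 := ⟨j - 1, by omega⟩
    have h := hb 0 (by omega)
    simp only [Nat.sub_zero] at h ⊢
    rw [show 2 * (i + 1) + 1 = (2 * i + 1) + 2 by ring, recPoly_add_two, recPoly_zero,
      zero_add, recPoly_one, ← h, show 2 * (i + 1) - 1 = 2 * i + 1 by omega,
      show 2 * (i + 1) = 2 * i + 1 + 1 by ring]
    ring
  | succ k ih =>
    obtain ⟨i, hi⟩ : ∃ i, 2 * j - k = i + 2 := ⟨2 * j - k - 2, by omega⟩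
    have hb1 := hb (k + 1) (by omega)
    have hu1 := hu (k + 1) (by omega) (by omega)
    rw [ih (by omega), recPoly_add_two b u k]
    rw [show 2 * j - (k + 1) = i + 1 by omega] at *
    rw [show 2 * j + 1 - (k + 1) = i + 2 by omega] at hu1
    rw [hi, show i + 2 - 1 = i + 1 by omega, show i + 1 - 1 = i by omega, recPoly_add_two b u i,
      hb1, hu1]
    ring

/-- Positivity of the Wronskian of neighbouring orthogonal polynomials. -/
theorem recPoly_wronskian_pos {b u : ℕ → ℝ} {m : ℕ} (hu : ∀ n, 1 ≤ n → n ≤ m → 0 < u n) (x : ℝ) :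
    0 < (derivative (recPoly b u (m + 1))).eval x * (recPoly b u m).eval x
      - (derivative (recPoly b u m)).eval x * (recPoly b u (m + 1)).eval x := by
  induction m with
  | zero => simp [recPoly_zero, recPoly_one]
  | succ m ih =>
    have h := ih fun n h1 h2 => hu n h1 (by omega)
    have hu1 := hu (m + 1) (by omega) le_rfl
    have := mul_pos hu1 h
    rw [recPoly_add_two]
    simp only [derivative_sub, derivative_mul, derivative_X, derivative_C, eval_sub, eval_add,
      eval_mul, eval_X, eval_C, sub_zero, one_mul, zero_mul, zero_add]
    -- The Wronskians satisfy `W_{m+1} = P_{m+1}² + u_{m+1} W_m`.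
    nlinarith [sq_nonneg ((recPoly b u (m + 1)).eval x)]

/-- A common zero of two neighbours would propagate down the recurrence to `P_0 = 1`. -/
theorem recPoly_eval_ne_zero_of_root {b u : ℕ → ℝ} {m : ℕ} (hu : ∀ n, 1 ≤ n → n ≤ m → u n ≠ 0)
    {x : ℝ} (hx : (recPoly b u (m + 1)).eval x = 0) : (recPoly b u m).eval x ≠ 0 := by
  induction m with
  | zero => simp [recPoly_zero]
  | succ m ih =>
    intro h
    have e := recPoly_eval_mul b u m x
    rw [hx, h] at e
    have hu1 := hu (m + 1) (by omega) le_rfl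
    have h0 : (recPoly b u m).eval x = 0 := by
      have : u (m + 1) * (recPoly b u m).eval x = 0 := by linarith
      exact (mul_eq_zero.1 this).resolve_left hu1
    exact ih (fun n h1 h2 => hu n h1 (by omega)) h h0

/-- Gauss quadrature at the zeros of `P_{m+1}`. -/
theorem recPoly_quadrature {b u y : ℕ → ℝ} {m : ℕ} (hu : ∀ n, 1 ≤ n → n ≤ m → u n ≠ 0)
    (hy : Set.InjOn y (range (m + 1)))
    (hP : recPoly b u (m + 1) = ∏ s ∈ range (m + 1), (X - C (y s)))
    {n : ℕ} (hn : n ≤ m) (p : ℝ[X]) (hp : p.natDegree ≤ n) :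
    ∑ s ∈ range (m + 1), (∏ k ∈ Icc 1 m, u k) /
        ((recPoly b u m).eval (y s) * ∏ r ∈ (range (m + 1)).erase s, (y s - y r))
        * ((recPoly b u n).eval (y s) * p.eval (y s)) =
      (∏ k ∈ Icc 1 n, u k) * p.coeff n := by
  have hroot : ∀ s ∈ range (m + 1), (recPoly b u (m + 1)).eval (y s) = 0 := by
    intro s hs
    rw [hP, eval_prod]
    exact prod_eq_zero hs (by simp)
  set lam : ℕ → ℝ := fun s => (∏ k ∈ Icc 1 m, u k) /
        ((recPoly b u m).eval (y s) * ∏ r ∈ (range (m + 1)).erase s, (y s - y r)) with hlam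
  have top : ∀ p : ℝ[X], p.natDegree ≤ m → ∑ s ∈ range (m + 1), lam s
      * ((recPoly b u m).eval (y s) * p.eval (y s)) = (∏ k ∈ Icc 1 m, u k) * p.coeff m := by
    intro p hp
    -- For `n = m` the factor `P_m(y_s)` cancels against the weight, leaving the divided-difference
    -- formula for the coefficient of degree `m`.
    have h := Lagrange.coeff_eq_sum hy (P := p) (by
      rw [card_range]
      exact lt_of_le_of_lt degree_le_natDegree (by exact_mod_cast Nat.lt_succ_of_le hp))
    rw [card_range, Nat.add_sub_cancel] at h
    rw [h, mul_sum]
    refine sum_congr rfl fun s hs => ?_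
    have h0 := recPoly_eval_ne_zero_of_root hu (hroot s hs)
    simp only [hlam]
    rw [div_mul_eq_mul_div, mul_div_assoc]
    congr 1
    exact mul_div_mul_left _ _ h0
  -- Descent from the top degree by the backward recurrence `u_{k+1} P_k = (X - b_{k+1}) P_{k+1} -
  -- P_{k+2}`. The second claim, about the next higher polynomial, disposes of the `P_{k+2}` term.
  have main : ∀ i, i ≤ m → ∀ p : ℝ[X],
      (p.natDegree ≤ m - i → ∑ s ∈ range (m + 1), lam s
        * ((recPoly b u (m - i)).eval (y s) * p.eval (y s))
          = (∏ k ∈ Icc 1 (m - i), u k) * p.coeff (m - i)) ∧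
      (p.natDegree ≤ m - i → ∑ s ∈ range (m + 1), lam s
        * ((recPoly b u (m - i + 1)).eval (y s) * p.eval (y s)) = 0) := by
    intro i
    induction i with
    | zero =>
      intro _ p
      refine ⟨top p, fun _ => sum_eq_zero fun s hs => ?_⟩
      rw [Nat.sub_zero, hroot s hs]; ring
    | succ i ih =>
      intro hi p
      obtain ⟨k, hk⟩ : ∃ k, m - i = k + 1 := ⟨m - i - 1, by omega⟩
      have ih := ih (by omega)
      rw [hk] at ih
      rw [show m - (i + 1) = k by omega]
      have hcoef : p.natDegree ≤ k → p.coeff (k + 1) = 0 := fun h =>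
        coeff_eq_zero_of_natDegree_lt (by omega)
      refine ⟨fun hp => ?_, fun hp => ?_⟩
      · have hd : ((X - C (b (k + 1))) * p).natDegree ≤ k + 1 := by
          refine natDegree_mul_le.trans ?_
          rw [natDegree_X_sub_C]; omega
        have h1 := (ih ((X - C (b (k + 1))) * p)).1 hd
        have h2 := (ih p).2 (by omega)
        have hc : ((X - C (b (k + 1))) * p).coeff (k + 1) = p.coeff k := by
          rw [sub_mul, coeff_sub, coeff_X_mul, coeff_C_mul, hcoef hp]; ring
        rw [hc, prod_Icc_succ_top (by omega)] at h1
        have h3 : u (k + 1) * ∑ s ∈ range (m + 1), lam s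
            * ((recPoly b u k).eval (y s) * p.eval (y s)) =
            u (k + 1) * ((∏ k ∈ Icc 1 k, u k) * p.coeff k) := by
          have : u (k + 1) * ∑ s ∈ range (m + 1), lam s
            * ((recPoly b u k).eval (y s) * p.eval (y s)) =
            ∑ s ∈ range (m + 1), lam s * ((recPoly b u (k + 1)).eval (y s)
              * ((X - C (b (k + 1))) * p).eval (y s)) - ∑ s ∈ range (m + 1), lam s
              * ((recPoly b u (k + 1 + 1)).eval (y s) * p.eval (y s)) := by
            rw [mul_sum, ← sum_sub_distrib]
            refine sum_congr rfl fun s _ => ?_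
            have e := recPoly_eval_mul b u k (y s)
            simp only [eval_mul, eval_sub, eval_X, eval_C]
            linear_combination -lam s * p.eval (y s) * e
          rw [this, h1, h2]; ring
        exact mul_left_cancel₀ (hu (k + 1) (by omega) (by omega)) h3
      · rw [(ih p).1 (by omega), hcoef hp, mul_zero]
  have := (main (m - n) (by omega) p).1
  rw [show m - (m - n) = n by omega] at this
  exact this hp

/-- Orthogonality from the vanishing of the functional on `P_1, …, P_N`. -/
theorem recPoly_orthogonal {b u w x : ℕ → ℝ} {N : ℕ}
    (hroot : ∀ s ∈ range (N + 1), (recPoly b u (N + 1)).eval (x s) = 0)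
    (h0 : ∀ n ≤ N, ∑ s ∈ range (N + 1), w s * (recPoly b u n).eval (x s) = if n = 0 then 1 else 0)
    (m : ℕ) (hm : m ≤ N) (n : ℕ) (hn : n ≤ N) :
    ∑ s ∈ range (N + 1), w s * (recPoly b u n).eval (x s) * (recPoly b u m).eval (x s) =
      if n = m then ∏ k ∈ Icc 1 n, u k else 0 := by
  set M : ℕ → ℕ → ℝ := fun n m =>
    ∑ s ∈ range (N + 1), w s * (recPoly b u n).eval (x s) * (recPoly b u m).eval (x s) with hM
  have htop : ∀ m, M (N + 1) m = 0 := fun m => sum_eq_zero fun s hs => by rw [hroot s hs]; ring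
  have hM0 : ∀ n ≤ N, M n 0 = if n = 0 then 1 else 0 := by
    intro n hn
    rw [← h0 n hn]
    simp only [hM, recPoly_zero, eval_one, mul_one]
  have hsymm : ∀ n m, M n m = M m n := fun n m => sum_congr rfl fun s _ => by ring
  -- Multiplication by `x` can be moved from one factor of the product to the other.
  have hrec : ∀ n m, M (n + 2) (m + 1) + b (n + 1) * M (n + 1) (m + 1) + u (n + 1) * M n (m + 1) =
      M (n + 1) (m + 2) + b (m + 1) * M (n + 1) (m + 1) + u (m + 1) * M (n + 1) m := by
    intro n m
    simp only [hM, mul_sum, ← sum_add_distrib]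
    refine sum_congr rfl fun s _ => ?_
    have e1 := recPoly_eval_mul b u n (x s)
    have e2 := recPoly_eval_mul b u m (x s)
    linear_combination w s * (recPoly b u (n + 1)).eval (x s) * e2
      - w s * (recPoly b u (m + 1)).eval (x s) * e1
  have hrec0 : ∀ n, M (n + 2) 0 + b (n + 1) * M (n + 1) 0 + u (n + 1) * M n 0 =
      M (n + 1) 1 + b 0 * M (n + 1) 0 := by
    intro n
    simp only [hM, mul_sum, ← sum_add_distrib]
    refine sum_congr rfl fun s _ => ?_
    have e1 := recPoly_eval_mul b u n (x s)
    simp only [recPoly_zero, recPoly_one, eval_one, eval_sub, eval_X, eval_C]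
    linear_combination - w s * e1
  -- Induction on the smaller index. Each step raises the larger index by one, and the range closes
  -- because row `N + 1` vanishes (`htop`).
  have key : ∀ m, ∀ n, m ≤ n → n ≤ N → M n m = if n = m then ∏ k ∈ Icc 1 n, u k else 0 := by
    intro m
    induction m using Nat.twoStepInduction with
    | zero =>
      intro n _ hn
      rw [hM0 n hn]
      split_ifs with h
      · subst h; simp
      · rfl
    | one =>
      intro n h1 hn
      obtain ⟨n, rfl⟩ : ∃ i, n = i + 1 := ⟨n - 1, by omega⟩
      have e := hrec0 n
      have e2 : M (n + 2) 0 = 0 := by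
        rcases Nat.lt_or_ge (n + 1) N with h | h
        · rw [hM0 _ (by omega), if_neg (by omega)]
        · rw [show n + 2 = N + 1 by omega, htop]
      have e3 : M (n + 1) 0 = 0 := by rw [hM0 _ hn, if_neg (by omega)]
      rw [e2, e3, hM0 n (by omega)] at e
      rcases Nat.eq_zero_or_pos n with h | h
      · subst h
        simp only [zero_add, if_true, Icc_self, prod_singleton] at e ⊢
        linarith
      · rw [if_neg (by omega)] at e ⊢
        linarith
    | more m ih1 ih2 =>
      intro n h1 hn
      obtain ⟨n, rfl⟩ : ∃ i, n = i + 1 := ⟨n - 1, by omega⟩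
      have e := hrec n m
      have e2 : M (n + 2) (m + 1) = 0 := by
        rcases Nat.lt_or_ge (n + 1) N with h | h
        · rw [ih2 _ (by omega) (by omega), if_neg (by omega)]
        · rw [show n + 2 = N + 1 by omega, htop]
      have e3 : M (n + 1) (m + 1) = 0 := by rw [ih2 _ (by omega) (by omega), if_neg (by omega)]
      have e4 : M (n + 1) m = 0 := by rw [ih1 _ (by omega) (by omega), if_neg (by omega)]
      rw [e2, e3, e4, ih2 n (by omega) (by omega)] at e
      rcases Nat.eq_or_lt_of_le h1 with h | h
      · rw [if_pos (by omega)] at e ⊢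
        rw [prod_Icc_succ_top (by omega)]
        linarith
      · rw [if_neg (by omega)] at e ⊢
        linarith
  rcases le_total m n with h | h
  · exact key m n h hn
  · change M n m = _
    rw [hsymm, key n m h hm]
    split_ifs with h1 h2 h2
    · rw [h1]
    · exact absurd h1.symm h2
    · exact absurd h2.symm h1
    · rfl

/-! ### Askey-Wilson coefficients and their truncation -/

/-- The diagonal recurrence coefficient of the monic Askey-Wilson polynomials. -/
noncomputable def awDiag (q a b c d : ℝ) (n : ℕ) : ℝ :=
  (a + a⁻¹ - awA q a b c d n - awC q a b c d n) / 2

/-- The off-diagonal recurrence coefficient of the monic Askey-Wilson polynomials. -/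
noncomputable def awOff (q a b c d : ℝ) (n : ℕ) : ℝ :=
  awA q a b c d (n - 1) * awC q a b c d n / 4

theorem awA_eq {q : ℝ} (hq : q ≠ 0) (a b c d : ℝ) (n : ℕ) :
    awA q a b c d n = (1 - a * b * q ^ n) * (1 - a * c * q ^ n) * (1 - a * d * q ^ n)
      * (1 - a * b * c * d * (q ^ n / q)) /
    (a * (1 - a * b * c * d * ((q ^ n) ^ 2 / q)) * (1 - a * b * c * d * (q ^ n) ^ 2)) := by
  have h2 : q ^ (2 * (n : ℤ)) = (q ^ n) ^ 2 := by
    rw [← pow_mul, ← zpow_natCast]; push_cast; ring_nf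
  rw [awA, zpow_sub_one₀ hq, zpow_sub_one₀ hq, h2, zpow_natCast, div_eq_mul_inv (q ^ n),
    div_eq_mul_inv ((q ^ n) ^ 2)]

theorem awC_eq {q : ℝ} (hq : q ≠ 0) (a b c d : ℝ) (n : ℕ) :
    awC q a b c d n = a * (1 - q ^ n) * (1 - b * c * (q ^ n / q)) * (1 - b * d * (q ^ n / q))
      * (1 - c * d * (q ^ n / q)) /
    ((1 - a * b * c * d * ((q ^ n) ^ 2 / q ^ 2)) * (1 - a * b * c * d * ((q ^ n) ^ 2 / q))) := by
  have h2 : q ^ (2 * (n : ℤ)) = (q ^ n) ^ 2 := by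
    rw [← pow_mul, ← zpow_natCast]; push_cast; ring_nf
  have h3 : q ^ (2 * (n : ℤ) - 2) = (q ^ n) ^ 2 / q ^ 2 := by
    rw [zpow_sub₀ hq, h2]; norm_cast
  rw [awC, zpow_sub_one₀ hq, zpow_sub_one₀ hq, h2, h3, zpow_natCast, div_eq_mul_inv (q ^ n),
    div_eq_mul_inv ((q ^ n) ^ 2) q]

theorem awC_zero (q a b c d : ℝ) : awC q a b c d 0 = 0 := by simp [awC]

theorem one_sub_pow_ne_zero {q S : ℝ} (H : ∀ l : ℤ, S * q ^ l ≠ 1) (hq : q ≠ 0) (n : ℕ) :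
    1 - S * ((q ^ n) ^ 2 / q ^ 2) ≠ 0 ∧ 1 - S * ((q ^ n) ^ 2 / q) ≠ 0 ∧
      1 - S * (q ^ n) ^ 2 ≠ 0 ∧ 1 - S * ((q ^ n) ^ 2 * q) ≠ 0 := by
  have h2 : q ^ (2 * (n : ℤ)) = (q ^ n) ^ 2 := by
    rw [← pow_mul, ← zpow_natCast]; push_cast; ring_nf
  have e1 := H (2 * n - 2)
  have e2 := H (2 * n - 1)
  have e3 := H (2 * n)
  have e4 := H (2 * n + 1)
  rw [zpow_sub₀ hq, h2] at e1
  rw [zpow_sub_one₀ hq, h2, ← div_eq_mul_inv] at e2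
  rw [h2] at e3
  rw [zpow_add_one₀ hq, h2] at e4
  refine ⟨fun h => e1 ?_, fun h => e2 ?_, fun h => e3 ?_, fun h => e4 ?_⟩
  · norm_cast at h ⊢; linarith
  all_goals linarith

/-- The diagonal of the UL product whose LU counterpart has the entries `A_n` and `C_n`; with
`aw_shift_off` it exhibits `a → aq` as a Christoffel transformation. -/
theorem aw_shift_diag {q a b c d : ℝ} (hq : q ≠ 0) (ha : a ≠ 0)
    (H : ∀ l : ℤ, a * b * c * d * q ^ l ≠ 1) (n : ℕ) :
    awDiag q (a * q) b c d n =
      (a + a⁻¹) / 2 - awA q a b c d n / 2 - awC q a b c d (n + 1 : ℕ) / 2 := by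
  obtain ⟨h1, h2, h3, h4⟩ := one_sub_pow_ne_zero H hq n
  rw [awDiag, awA_eq hq, awC_eq hq, awA_eq hq, awC_eq hq]
  rw [show a * q * b * c * d * ((q ^ n) ^ 2 / q) = a * b * c * d * (q ^ n) ^ 2 by field_simp,
    show a * q * b * c * d * ((q ^ n) ^ 2 / q ^ 2) = a * b * c * d * ((q ^ n) ^ 2 / q) by
      field_simp,
    show a * q * b * c * d * (q ^ n) ^ 2 = a * b * c * d * ((q ^ n) ^ 2 * q) by ring,
    show a * b * c * d * ((q ^ (n + 1)) ^ 2 / q ^ 2) = a * b * c * d * (q ^ n) ^ 2 by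
      field_simp; ring,
    show a * b * c * d * ((q ^ (n + 1)) ^ 2 / q) = a * b * c * d * ((q ^ n) ^ 2 * q) by
      field_simp; ring,
    show q ^ (n + 1) / q = q ^ n by field_simp; ring, pow_succ q n]
  generalize q ^ n = p at *
  have h2' : q - a * b * c * d * p ^ 2 ≠ 0 := by
    intro h; apply h2; field_simp; linear_combination h
  rw [show 1 - a * b * c * d * (p ^ 2 / q) = (q - a * b * c * d * p ^ 2) / q by field_simp] at *
  rw [show 1 - a * b * c * d * (p / q) = (q - a * b * c * d * p) / q by field_simp] at *
  generalize h1e : q - a * b * c * d * p ^ 2 = D1 at *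
  generalize h3e : 1 - a * b * c * d * p ^ 2 = D3 at *
  generalize h4e : 1 - a * b * c * d * (p ^ 2 * q) = D4 at *
  field_simp
  rw [← h1e, ← h3e, ← h4e]
  ring

theorem aw_shift_off {q a b c d : ℝ} (hq : q ≠ 0) (ha : a ≠ 0) (n : ℕ) :
    awOff q (a * q) b c d (n + 1) = awA q a b c d (n + 1 : ℕ) * awC q a b c d (n + 1 : ℕ) / 4 := by
  rw [awOff, show ((n + 1 : ℕ) : ℤ) - 1 = (n : ℕ) by push_cast; ring, awA_eq hq, awC_eq hq,
    awA_eq hq, awC_eq hq, div_mul_div_comm, div_mul_div_comm]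
  rw [show a * q * b * c * d * ((q ^ n) ^ 2 / q) = a * b * c * d * ((q ^ (n + 1)) ^ 2 / q ^ 2) by
      field_simp; ring,
    show a * q * b * c * d * ((q ^ (n + 1)) ^ 2 / q ^ 2) =
      a * b * c * d * ((q ^ (n + 1)) ^ 2 / q) by field_simp,
    show a * q * b * c * d * (q ^ n) ^ 2 = a * b * c * d * ((q ^ (n + 1)) ^ 2 / q) by
      field_simp; ring,
    show a * q * b * c * d * ((q ^ (n + 1)) ^ 2 / q) = a * b * c * d * (q ^ (n + 1)) ^ 2 by
      field_simp,
    show a * q * b * c * d * (q ^ n / q) = a * b * c * d * (q ^ (n + 1) / q) by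
      field_simp; ring,
    show a * q * b * q ^ n = a * b * q ^ (n + 1) by ring,
    show a * q * c * q ^ n = a * c * q ^ (n + 1) by ring,
    show a * q * d * q ^ n = a * d * q ^ (n + 1) by ring]
  have e : ∀ z x y D₁ D₂ D₃ D₄ : ℝ, z ≠ 0 → z * x * y / (z * D₁ * D₂ * (D₃ * D₄)) =
      x * y / (D₁ * D₂ * D₃ * D₄) := by
    intros; field_simp
  have e' : ∀ z x y D₁ D₂ D₃ D₄ : ℝ, z ≠ 0 → x * (z * y) / (z * D₁ * D₂ * (D₃ * D₄)) =
      x * y / (D₁ * D₂ * D₃ * D₄) := by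
    intros; field_simp
  have hn : ∀ z x y₁ y₂ y₃ y₄ : ℝ, x * (z * y₁ * y₂ * y₃ * y₄) = x * (z * (y₁ * y₂ * y₃ * y₄)) := by
    intros; ring
  rw [hn, hn, e' _ _ _ _ _ _ _ (mul_ne_zero ha hq), e' _ _ _ _ _ _ _ ha]
  congr 2
  ring

/-- The symmetry of the Askey-Wilson polynomials in their parameters, needed only for exchanging the
pairs `(a, b)` and `(c, d)`. It carries the truncation result over to the condition on `cd`. -/
theorem aw_swap_diag {q a b c d : ℝ} (hq : q ≠ 0) (ha : a ≠ 0) (hc : c ≠ 0)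
    (H : ∀ l : ℤ, a * b * c * d * q ^ l ≠ 1) (n : ℕ) :
    awDiag q c d a b n = awDiag q a b c d n := by
  obtain ⟨h1, h2, h3, -⟩ := one_sub_pow_ne_zero H hq n
  rw [awDiag, awDiag, awA_eq hq, awC_eq hq, awA_eq hq, awC_eq hq]
  rw [show c * d * a * b = a * b * c * d by ring]
  generalize q ^ n = p at *
  have h1' : q ^ 2 - a * b * c * d * p ^ 2 ≠ 0 := by
    intro h; apply h1; field_simp; linear_combination h
  have h2' : q - a * b * c * d * p ^ 2 ≠ 0 := by
    intro h; apply h2; field_simp; linear_combination h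
  rw [show 1 - a * b * c * d * (p ^ 2 / q) = (q - a * b * c * d * p ^ 2) / q by field_simp,
    show 1 - a * b * c * d * (p ^ 2 / q ^ 2) = (q ^ 2 - a * b * c * d * p ^ 2) / q ^ 2 by
      field_simp] at *
  generalize h1e : q ^ 2 - a * b * c * d * p ^ 2 = D1 at *
  generalize h2e : q - a * b * c * d * p ^ 2 = D2 at *
  generalize h3e : 1 - a * b * c * d * p ^ 2 = D3 at *
  field_simp
  rw [← h1e, ← h2e, ← h3e]
  ring

theorem aw_swap_off {q a b c d : ℝ} (hq : q ≠ 0) (ha : a ≠ 0) (hc : c ≠ 0) (n : ℕ) :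
    awOff q c d a b (n + 1) = awOff q a b c d (n + 1) := by
  rw [awOff, awOff, show ((n + 1 : ℕ) : ℤ) - 1 = (n : ℕ) by push_cast; ring, awA_eq hq, awC_eq hq,
    awA_eq hq, awC_eq hq]
  rw [show c * d * a * b = a * b * c * d by ring, show q ^ (n + 1) / q = q ^ n by field_simp; ring]
  have e : ∀ z x₁ x₂ x₃ x₄ y₁ y₂ y₃ y₄ D₁ D₂ D₃ : ℝ, z ≠ 0 →
      x₁ * x₂ * x₃ * x₄ / (z * D₁ * D₂) * (z * y₁ * y₂ * y₃ * y₄ / D₃) =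
        x₁ * x₂ * x₃ * x₄ * (y₁ * y₂ * y₃ * y₄) / (D₁ * D₂ * D₃) := by
    intro z x₁ x₂ x₃ x₄ y₁ y₂ y₃ y₄ D₁ D₂ D₃ hz
    rw [div_mul_div_comm, ← mul_div_mul_left _ (D₁ * D₂ * D₃) hz]
    congr 1 <;> ring
  rw [e c _ _ _ _ _ _ _ _ _ _ _ hc, e a _ _ _ _ _ _ _ _ _ _ _ ha]
  congr 2
  ring

/-- The zeros of a monic Askey-Wilson polynomial of degree `m + 1` when `ab = q^{-m}`. -/
theorem aw_truncation {q : ℝ} (hq : q ≠ 0) (b c d : ℝ) (m : ℕ) (a : ℝ) (ha : a ≠ 0)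
    (H : ∀ l : ℤ, a * b * c * d * q ^ l ≠ 1) (hab : a * b * q ^ m = 1) :
    recPoly (awDiag q a b c d) (awOff q a b c d) (m + 1) =
      ∏ s ∈ range (m + 1), (X - C (lattice q a s)) := by
  induction m generalizing a with
  | zero =>
    have h0 : awA q a b c d (0 : ℕ) = 0 := by
      rw [awA_eq hq, hab, sub_self]
      simp only [zero_mul, zero_div]
    rw [zero_add, recPoly_one, prod_range_one, awDiag, h0, Nat.cast_zero, awC_zero, lattice]
    simp [add_comm]
  | succ m ih =>
    have hA : awA q a b c d (m + 1 : ℕ) = 0 := by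
      rw [awA_eq hq, hab, sub_self]
      simp only [zero_mul, zero_div]
    -- Used at index `m + 1`, where the correction term carries `A_{m+1} = 0`, so that the
    -- transformed polynomial is an exact cofactor of `X - (a + a⁻¹)/2`.
    have hch := (recPoly_christoffel (A := fun n => awA q a b c d n / 2)
      (B := fun n => awC q a b c d n / 2) (b := awDiag q a b c d) (u := awOff q a b c d)
      (b' := awDiag q (a * q) b c d) (u' := awOff q (a * q) b c d) (y := (a + a⁻¹) / 2)
      (by simp [awC_zero]) (fun n => by rw [awDiag]; ring)
      (fun n => by rw [awOff]; push_cast; rw [add_sub_cancel_right]; ring)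
      (fun n => aw_shift_diag hq ha H n)
      (fun n => by rw [aw_shift_off hq ha]; ring) (m + 1)).1
    simp only [hA, zero_div, C_0, zero_mul, sub_zero] at hch
    have hq' : ∀ l : ℤ, a * q * b * c * d * q ^ l ≠ 1 := by
      intro l h
      apply H (l + 1)
      rw [zpow_add_one₀ hq]
      linear_combination h
    rw [← hch, ih (a * q) (mul_ne_zero ha hq) hq' (by rw [← hab]; ring),
      prod_range_succ' _ (m + 1), mul_comm]
    congr 1
    · refine prod_congr rfl fun s _ => ?_
      congr 2
      simp only [lattice]
      push_cast
      rw [neg_add, zpow_add₀ hq, zpow_neg_one, pow_succ, mul_inv]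
      ring
    · simp [lattice, add_comm]

/-! ### The singular limit of the coefficients -/

/-- A quotient of derivatives at `t = 0`; the source of `α = e₁ / (e₁ + e₂)`. -/
theorem tendsto_one_sub_rpow_ratio {q e₁ e : ℝ} (hq0 : 0 < q) (hq1 : q < 1) (he : e ≠ 0) :
    Tendsto (fun t : ℝ => (1 - q ^ (e₁ * t)) / (1 - q ^ (e * t))) (𝓝[≠] 0) (𝓝 (e₁ / e)) := by
  have hlog : Real.log q ≠ 0 := (Real.log_neg hq0 hq1).ne
  have hd : ∀ e : ℝ, Tendsto (fun t : ℝ => t⁻¹ * (1 - q ^ (e * t))) (𝓝[≠] 0)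
      (𝓝 (-(Real.log q * e))) := by
    intro e
    have h : HasDerivAt (fun t : ℝ => q ^ (e * t)) (Real.log q * e) 0 := by
      have h1 := ((hasDerivAt_id (0 : ℝ)).const_mul e).const_rpow hq0
      simpa using h1
    have h2 := hasDerivAt_iff_tendsto_slope_zero.1 h
    simp only [zero_add, mul_zero, Real.rpow_zero, smul_eq_mul] at h2
    refine h2.neg.congr fun t => ?_
    ring
  have h := (hd e₁).div (hd e) (neg_ne_zero.2 (mul_ne_zero hlog he))
  rw [neg_div_neg_eq, mul_div_mul_left _ _ hlog] at h
  refine h.congr' ?_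
  filter_upwards [self_mem_nhdsWithin] with t ht
  exact mul_div_mul_left _ _ (inv_ne_zero ht)

theorem tendsto_rpow_mul {q : ℝ} (hq0 : 0 < q) (e : ℝ) :
    Tendsto (fun t : ℝ => q ^ (e * t)) (𝓝[≠] 0) (𝓝 1) := by
  have h : Continuous fun t : ℝ => q ^ (e * t) :=
    Real.continuous_const_rpow hq0.ne' |>.comp (continuous_const.mul continuous_id)
  have := h.tendsto 0
  simp only [mul_zero, Real.rpow_zero] at this
  exact this.mono_left nhdsWithin_le_nhds

theorem bPar_eq {q : ℝ} (hq0 : 0 < q) (a e₁ : ℝ) (j : ℕ) (t : ℝ) :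
    bPar q a e₁ j t = a⁻¹ * (q ^ (e₁ * t) / q ^ j) := by
  rw [bPar, Real.rpow_add hq0, Real.rpow_neg hq0.le, Real.rpow_natCast]; ring

theorem dPar_eq {q : ℝ} (hq0 : 0 < q) (c e₂ : ℝ) (j : ℕ) (t : ℝ) :
    dPar q c e₂ j t = c⁻¹ * (q * q ^ (e₂ * t) / q ^ j) := by
  rw [dPar, Real.rpow_add hq0, Real.rpow_add hq0, Real.rpow_neg hq0.le, Real.rpow_natCast,
    Real.rpow_one]; ring

theorem pow_ne_pow_of_ne {q : ℝ} (hq0 : 0 < q) (hq1 : q < 1) {m n : ℕ} (h : m ≠ n) :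
    q ^ m ≠ q ^ n := fun h' => h (pow_right_injective₀ hq0 hq1.ne h')

/-- The limit of `A_n` for `n ≠ j`. -/
noncomputable def limA (q a c : ℝ) (j n : ℕ) : ℝ :=
  (1 - a * c * q ^ n) * (c * q ^ j - a * q * q ^ n) * ((q ^ j) ^ 2 - q ^ n) /
    (a * c * ((q ^ j) ^ 2 - q * (q ^ n) ^ 2) * (q ^ j + q ^ n))

/-- The limit of `C_n` for `n ≠ j`. -/
noncomputable def limC (q a c : ℝ) (j n : ℕ) : ℝ :=
  (1 - q ^ n) * (a * q * q ^ j - c * q ^ n) * (a * c * (q ^ j) ^ 2 - q ^ n) /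
    (a * c * (q * (q ^ j) ^ 2 - (q ^ n) ^ 2) * (q ^ j + q ^ n))

theorem lim_denom_ne_zero {q : ℝ} (hq0 : 0 < q) (hq1 : q < 1) (j n : ℕ) :
    (q ^ j) ^ 2 - q * (q ^ n) ^ 2 ≠ 0 ∧ q * (q ^ j) ^ 2 - (q ^ n) ^ 2 ≠ 0 := by
  have h1 := pow_ne_pow_of_ne hq0 hq1 (show 2 * j ≠ 2 * n + 1 by omega)
  have h2 := pow_ne_pow_of_ne hq0 hq1 (show 2 * j + 1 ≠ 2 * n by omega)
  constructor
  · intro h; apply h1; rw [pow_succ, pow_mul', pow_mul']; linear_combination h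
  · intro h; apply h2; rw [pow_succ, pow_mul', pow_mul']; linear_combination h

theorem one_sub_denom_ne_zero {q : ℝ} (hq0 : 0 < q) (hq1 : q < 1) (j n : ℕ) :
    1 - q * (q ^ n) ^ 2 / (q ^ j) ^ 2 ≠ 0 ∧ 1 - (q ^ n) ^ 2 / (q * (q ^ j) ^ 2) ≠ 0 := by
  obtain ⟨h1, h2⟩ := lim_denom_ne_zero hq0 hq1 j n
  have hr : q ^ j ≠ 0 := pow_ne_zero _ hq0.ne'
  constructor
  · intro h; apply h1; field_simp at h; linarith
  · intro h; apply h2; field_simp at h; linarith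

/-- The behaviour of the factor that becomes singular for `n = j`. -/
theorem tendsto_singular_factor {q e₁ e₂ α : ℝ} (hq0 : 0 < q) (hq1 : q < 1) (he : e₁ + e₂ ≠ 0)
    (hα : e₁ / (e₁ + e₂) = α) (j n : ℕ) :
    Tendsto (fun t : ℝ => (1 - q ^ (e₁ * t) * q ^ n / q ^ j) /
      (1 - q ^ (e₁ * t) * q ^ (e₂ * t) * (q ^ n) ^ 2 / (q ^ j) ^ 2)) (𝓝[≠] 0)
      (𝓝 ((if n = j then 2 * α else 1) * (q ^ j / (q ^ j + q ^ n)))) := by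
  have hr : 0 < q ^ j := pow_pos hq0 _
  have hp : 0 < q ^ n := pow_pos hq0 _
  split_ifs with h
  · subst h
    -- The regular formula gives `1/2` at `n = j`, so the true limit `α` appears as `2α` times it.
    rw [show 2 * α * (q ^ n / (q ^ n + q ^ n)) = α by field_simp; ring, ← hα]
    refine (tendsto_one_sub_rpow_ratio (e₁ := e₁) hq0 hq1 he).congr fun t => ?_
    rw [add_mul, Real.rpow_add hq0, mul_div_cancel_right₀ _ hp.ne',
      mul_div_cancel_right₀ _ (pow_ne_zero 2 hp.ne')]
  · have hne := pow_ne_pow_of_ne hq0 hq1 h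
    have h1 : 1 - q ^ n / q ^ j ≠ 0 := by
      intro h'; apply hne; field_simp at h'; linarith
    have h2 : 1 - 1 * 1 * (q ^ n) ^ 2 / (q ^ j) ^ 2 ≠ 0 := by
      rw [show 1 - 1 * 1 * (q ^ n) ^ 2 / (q ^ j) ^ 2 =
        (1 - q ^ n / q ^ j) * (1 + q ^ n / q ^ j) by field_simp; ring]
      exact mul_ne_zero h1 (by positivity)
    have := (tendsto_const_nhds (x := (1 : ℝ))).sub
        (((tendsto_rpow_mul hq0 e₁).mul_const (q ^ n)).div_const (q ^ j)) |>.div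
      ((tendsto_const_nhds (x := (1 : ℝ))).sub
        ((((tendsto_rpow_mul hq0 e₁).mul (tendsto_rpow_mul hq0 e₂)).mul_const
          ((q ^ n) ^ 2)).div_const ((q ^ j) ^ 2))) h2
    have hL : 1 * (q ^ j / (q ^ j + q ^ n)) =
        (1 - 1 * q ^ n / q ^ j) / (1 - 1 * 1 * (q ^ n) ^ 2 / (q ^ j) ^ 2) := by
      rw [eq_div_iff h2]
      field_simp
      ring
    rw [hL]
    exact this

theorem tendsto_awA {q a c e₁ e₂ α : ℝ} (hq0 : 0 < q) (hq1 : q < 1) (ha : a ≠ 0) (hc : c ≠ 0)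
    (he : e₁ + e₂ ≠ 0) (hα : e₁ / (e₁ + e₂) = α) (j n : ℕ) :
    Tendsto (fun t : ℝ => awA q a (bPar q a e₁ j t) c (dPar q c e₂ j t) n) (𝓝[≠] 0)
      (𝓝 ((if n = j then 2 * α else 1) * limA q a c j n)) := by
  have hr : 0 < q ^ j := pow_pos hq0 _
  have hp : 0 < q ^ n := pow_pos hq0 _
  obtain ⟨h3, -⟩ := one_sub_denom_ne_zero hq0 hq1 j n
  obtain ⟨h4, -⟩ := lim_denom_ne_zero hq0 hq1 j n
  have hX := tendsto_rpow_mul hq0 e₁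
  have hY := tendsto_rpow_mul hq0 e₂
  have hG : Tendsto (fun t : ℝ => (1 - a * c * q ^ n) * (1 - a / c * (q ^ n / q ^ j * q)
      * q ^ (e₂ * t)) * (1 - q ^ (e₁ * t) * q ^ (e₂ * t) * (q ^ n / (q ^ j) ^ 2)) /
      (a * (1 - q ^ (e₁ * t) * q ^ (e₂ * t) * (q * (q ^ n) ^ 2 / (q ^ j) ^ 2)))) (𝓝[≠] 0) _ :=
    ((tendsto_const_nhds.mul (tendsto_const_nhds.sub (tendsto_const_nhds.mul hY))).mul
      (tendsto_const_nhds.sub ((hX.mul hY).mul_const _))).div (tendsto_const_nhds.mul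
      (tendsto_const_nhds.sub ((hX.mul hY).mul_const _))) (by
        rw [one_mul, one_mul]; exact mul_ne_zero ha h3)
  have := (tendsto_singular_factor hq0 hq1 he hα j n).mul hG
  have hL : (if n = j then 2 * α else 1) * limA q a c j n =
      (if n = j then 2 * α else 1) * (q ^ j / (q ^ j + q ^ n)) *
        ((1 - a * c * q ^ n) * (1 - a / c * (q ^ n / q ^ j * q) * 1)
          * (1 - 1 * 1 * (q ^ n / (q ^ j) ^ 2)) /
        (a * (1 - 1 * 1 * (q * (q ^ n) ^ 2 / (q ^ j) ^ 2)))) := by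
    rw [mul_assoc]
    congr 1
    rw [limA, div_mul_div_comm, mul_one (1 : ℝ), one_mul, one_mul]
    rw [show 1 - q * (q ^ n) ^ 2 / (q ^ j) ^ 2 = ((q ^ j) ^ 2 - q * (q ^ n) ^ 2) / (q ^ j) ^ 2 by
      field_simp]
    generalize (q ^ j) ^ 2 - q * (q ^ n) ^ 2 = D at *
    field_simp
  rw [hL]
  refine this.congr fun t => ?_
  rw [awA_eq hq0.ne', bPar_eq hq0, dPar_eq hq0]
  generalize q ^ (e₁ * t) = U
  generalize q ^ (e₂ * t) = V
  rw [div_mul_div_comm]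
  have hq := hq0.ne'
  congr 1
  · field_simp
  · field_simp

theorem tendsto_awC {q a c e₁ e₂ α : ℝ} (hq0 : 0 < q) (hq1 : q < 1) (ha : a ≠ 0) (hc : c ≠ 0)
    (he : e₁ + e₂ ≠ 0) (hα : e₁ / (e₁ + e₂) = α) (j n : ℕ) :
    Tendsto (fun t : ℝ => awC q a (bPar q a e₁ j t) c (dPar q c e₂ j t) n) (𝓝[≠] 0)
      (𝓝 ((if n = j then 2 * (1 - α) else 1) * limC q a c j n)) := by
  have hr : 0 < q ^ j := pow_pos hq0 _
  have hp : 0 < q ^ n := pow_pos hq0 _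
  obtain ⟨-, h3⟩ := one_sub_denom_ne_zero hq0 hq1 j n
  obtain ⟨-, h4⟩ := lim_denom_ne_zero hq0 hq1 j n
  have hX := tendsto_rpow_mul hq0 e₁
  have hY := tendsto_rpow_mul hq0 e₂
  -- In `C_n` the singular numerator is `1 - cdq^{n-1}`, governed by `e₂`; exchanging the exponents
  -- turns `α` into `1 - α`.
  have hα' : e₂ / (e₂ + e₁) = 1 - α := by
    rw [add_comm] at he
    rw [← hα, add_comm e₁]; field_simp; ring
  have hG : Tendsto (fun t : ℝ => a * (1 - q ^ n) * (1 - c / a * (q ^ n / (q * q ^ j))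
      * q ^ (e₁ * t)) * (1 - q ^ (e₁ * t) * q ^ (e₂ * t) * (q ^ n / (a * c * (q ^ j) ^ 2))) /
      (1 - q ^ (e₁ * t) * q ^ (e₂ * t) * ((q ^ n) ^ 2 / (q * (q ^ j) ^ 2)))) (𝓝[≠] 0) _ :=
    ((tendsto_const_nhds.mul (tendsto_const_nhds.sub (tendsto_const_nhds.mul hX))).mul
      (tendsto_const_nhds.sub ((hX.mul hY).mul_const _))).div
      (tendsto_const_nhds.sub ((hX.mul hY).mul_const _)) (by rw [one_mul, one_mul]; exact h3)
  have := (tendsto_singular_factor hq0 hq1 (by rwa [add_comm]) hα' j n).mul hG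
  have hL : (if n = j then 2 * (1 - α) else 1) * limC q a c j n =
      (if n = j then 2 * (1 - α) else 1) * (q ^ j / (q ^ j + q ^ n)) *
        (a * (1 - q ^ n) * (1 - c / a * (q ^ n / (q * q ^ j)) * 1)
          * (1 - 1 * 1 * (q ^ n / (a * c * (q ^ j) ^ 2))) /
        (1 - 1 * 1 * ((q ^ n) ^ 2 / (q * (q ^ j) ^ 2)))) := by
    rw [mul_assoc]
    congr 1
    rw [limC, div_mul_div_comm, mul_one (1 : ℝ), one_mul, one_mul]
    rw [show 1 - (q ^ n) ^ 2 / (q * (q ^ j) ^ 2) =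
      (q * (q ^ j) ^ 2 - (q ^ n) ^ 2) / (q * (q ^ j) ^ 2) by field_simp]
    generalize q * (q ^ j) ^ 2 - (q ^ n) ^ 2 = D at *
    field_simp
  rw [hL]
  refine this.congr fun t => ?_
  rw [awC_eq hq0.ne', bPar_eq hq0, dPar_eq hq0]
  generalize q ^ (e₁ * t) = U
  generalize q ^ (e₂ * t) = V
  rw [div_mul_div_comm]
  have hq := hq0.ne'
  congr 1
  · field_simp
  · field_simp

theorem bCoef_eq_lim {q a c : ℝ} (hq0 : 0 < q) (hq1 : q < 1) (ha : a ≠ 0) (hc : c ≠ 0)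
    (j n : ℕ) : bCoef q a c j n = (a + a⁻¹ - limA q a c j n - limC q a c j n) / 2 := by
  have hr : 0 < q ^ j := pow_pos hq0 _
  have hp : 0 < q ^ n := pow_pos hq0 _
  obtain ⟨h1, h2⟩ := lim_denom_ne_zero hq0 hq1 j n
  have e2 : ∀ k, q ^ (2 * k) = (q ^ k) ^ 2 := fun k => by rw [pow_mul']
  have e3 : ∀ k, q ^ (2 * k + 1) = q * (q ^ k) ^ 2 := fun k => by rw [pow_succ, e2]; ring
  rw [bCoef, limA, limC, e3, e3, e2, e2, pow_succ q n, pow_succ q j]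
  generalize q ^ j = r at *
  generalize q ^ n = p at *
  generalize h1e : r ^ 2 - q * p ^ 2 = D₁ at *
  generalize h2e : q * r ^ 2 - p ^ 2 = D₂ at *
  field_simp
  rw [← h1e, ← h2e]
  ring

/-- At `n = j` the limits of `A_j` and `C_j` are `2α` and `2(1 - α)` times this common value. Their
sum is therefore free of `α`, and the formula for `b_n` needs no exception at `n = j`. -/
theorem limA_self_eq_limC (q a c : ℝ) (j : ℕ) : limA q a c j j = limC q a c j j := by
  rw [limA, limC, show a * c * (q * (q ^ j) ^ 2 - (q ^ j) ^ 2) * (q ^ j + q ^ j) =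
    -(a * c * ((q ^ j) ^ 2 - q * (q ^ j) ^ 2) * (q ^ j + q ^ j)) by ring, div_neg, ← neg_div]
  congr 1
  ring

theorem uMid_eq_lim_succ {q a c : ℝ} (hq0 : 0 < q) (hq1 : q < 1) (ha : a ≠ 0) (hc : c ≠ 0)
    (j : ℕ) : uMid q a c j = 2 * limA q a c j j * limC q a c j (j + 1) / 4 := by
  have hr : 0 < q ^ j := pow_pos hq0 _
  have hw : 1 - q ≠ 0 := by linarith
  have e : q ^ (-(2 * j : ℤ)) = ((q ^ j) ^ 2)⁻¹ := by
    rw [zpow_neg, ← pow_mul']; norm_cast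
  rw [uMid, limA, limC, e, pow_succ q j]
  generalize q ^ j = r at *
  rw [show r ^ 2 - q * r ^ 2 = r ^ 2 * (1 - q) by ring,
    show q * r ^ 2 - (r * q) ^ 2 = q * r ^ 2 * (1 - q) by ring,
    show (q - 1) ^ 2 = (1 - q) ^ 2 by ring, show r + r * q = r * (1 + q) by ring, add_comm q 1]
  generalize hwe : 1 - q = w at *
  field_simp
  ring

theorem uMid_eq_lim_pred {q a c : ℝ} (hq0 : 0 < q) (hq1 : q < 1) (ha : a ≠ 0) (hc : c ≠ 0)
    (n : ℕ) : uMid q a c (n + 1) = limA q a c (n + 1) n * (2 * limC q a c (n + 1) (n + 1)) / 4 := by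
  have hr : 0 < q ^ n := pow_pos hq0 _
  have hw : 1 - q ≠ 0 := by linarith
  have e : q ^ (-(2 * (n + 1 : ℕ) : ℤ)) = ((q ^ n * q) ^ 2)⁻¹ := by
    rw [zpow_neg, ← pow_succ, ← pow_mul']; norm_cast
  rw [uMid, limA, limC, e, pow_succ q (n + 1), pow_succ q n]
  generalize q ^ n = r at *
  rw [show (r * q) ^ 2 - q * r ^ 2 = -(q * r ^ 2 * (1 - q)) by ring,
    show q * (r * q) ^ 2 - (r * q) ^ 2 = -(r ^ 2 * q ^ 2 * (1 - q)) by ring,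
    show (q - 1) ^ 2 = (1 - q) ^ 2 by ring, show r * q + r = r * (1 + q) by ring, add_comm q 1]
  generalize hwe : 1 - q = w at *
  field_simp
  ring

/-- Only `A_j` and `C_j` carry `α`, so only `u_{j+1} = A_j C_{j+1} / 4` and `u_j = A_{j-1} C_j / 4`
are exceptional. -/
theorem uCoef_succ_eq_lim {q a c : ℝ} (hq0 : 0 < q) (hq1 : q < 1) (ha : a ≠ 0) (hc : c ≠ 0)
    (α : ℝ) (j n : ℕ) : uCoef q a c α j (n + 1) =
      (if n = j then 2 * α else 1) * limA q a c j n
        * ((if n + 1 = j then 2 * (1 - α) else 1) * limC q a c j (n + 1)) / 4 := by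
  rw [uCoef]
  rcases eq_or_ne (n + 1) j with h | h
  · subst h
    rw [if_pos rfl, if_neg (by omega), if_pos rfl, uMid_eq_lim_pred hq0 hq1 ha hc]
    ring
  rw [if_neg h, if_neg h]
  rcases eq_or_ne n j with h' | h'
  · subst h'
    rw [if_pos rfl, if_pos rfl, uMid_eq_lim_succ hq0 hq1 ha hc]
    ring
  rw [if_neg (by omega), if_neg h', limA, limC]
  have hr : 0 < q ^ j := pow_pos hq0 _
  have hp : 0 < q ^ n := pow_pos hq0 _
  obtain ⟨h1, -⟩ := lim_denom_ne_zero hq0 hq1 j n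
  have e2 : ∀ k, q ^ (2 * k) = (q ^ k) ^ 2 := fun k => by rw [pow_mul']
  have e3 : ∀ k, q ^ (2 * k + 1) = q * (q ^ k) ^ 2 := fun k => by rw [pow_succ, e2]; ring
  rw [e3, e2, e2, pow_succ q n, pow_succ q j]
  generalize q ^ j = r at *
  generalize q ^ n = p at *
  rw [show q * r ^ 2 - (p * q) ^ 2 = q * (r ^ 2 - q * p ^ 2) by ring,
    show r * q + p * q = q * (r + p) by ring]
  generalize h1e : r ^ 2 - q * p ^ 2 = D₁ at *
  field_simp
  ring

theorem tendsto_awDiag {q a c e₁ e₂ α : ℝ} (hq0 : 0 < q) (hq1 : q < 1) (ha : a ≠ 0) (hc : c ≠ 0)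
    (he : e₁ + e₂ ≠ 0) (hα : e₁ / (e₁ + e₂) = α) (j n : ℕ) :
    Tendsto (fun t : ℝ => awDiag q a (bPar q a e₁ j t) c (dPar q c e₂ j t) n) (𝓝[≠] 0)
      (𝓝 (bCoef q a c j n)) := by
  have h := ((tendsto_const_nhds (x := a + a⁻¹)).sub (tendsto_awA hq0 hq1 ha hc he hα j n)).sub
    (tendsto_awC hq0 hq1 ha hc he hα j n) |>.div_const 2
  have hL : bCoef q a c j n = (a + a⁻¹ - (if n = j then 2 * α else 1) * limA q a c j n
      - (if n = j then 2 * (1 - α) else 1) * limC q a c j n) / 2 := by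
    rw [bCoef_eq_lim hq0 hq1 ha hc]
    split_ifs with h
    · rw [h, limA_self_eq_limC]; ring
    · ring
  rw [hL]
  exact h

theorem tendsto_awOff {q a c e₁ e₂ α : ℝ} (hq0 : 0 < q) (hq1 : q < 1) (ha : a ≠ 0) (hc : c ≠ 0)
    (he : e₁ + e₂ ≠ 0) (hα : e₁ / (e₁ + e₂) = α) (j n : ℕ) (hn : 1 ≤ n) :
    Tendsto (fun t : ℝ => awOff q a (bPar q a e₁ j t) c (dPar q c e₂ j t) n) (𝓝[≠] 0)
      (𝓝 (uCoef q a c α j n)) := by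
  obtain ⟨n, rfl⟩ : ∃ i, n = i + 1 := ⟨n - 1, by omega⟩
  have h := (tendsto_awA hq0 hq1 ha hc he hα j n).mul
    (tendsto_awC hq0 hq1 ha hc he hα j (n + 1)) |>.div_const 4
  rw [uCoef_succ_eq_lim hq0 hq1 ha hc]
  refine h.congr fun t => ?_
  rw [awOff]
  push_cast
  rw [add_sub_cancel_right]

/-- Here `abcdq^l` equals `q^{t + k}` with an integer `k`, which is not `1` while `0 < |t| < 1`. All
Askey-Wilson denominators are thus nonzero near, but not at, `t = 0`. -/
theorem aw_generic {q a c e₁ e₂ : ℝ} (hq0 : 0 < q) (hq1 : q < 1) (ha : a ≠ 0) (hc : c ≠ 0)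
    (he : e₁ + e₂ = 1) (j : ℕ) : ∀ᶠ t : ℝ in 𝓝[≠] 0, ∀ l : ℤ,
      a * bPar q a e₁ j t * c * dPar q c e₂ j t * q ^ l ≠ 1 := by
  have hball : ∀ᶠ t : ℝ in 𝓝[≠] 0, |t| < 1 :=
    nhdsWithin_le_nhds (continuous_abs.continuousAt.eventually_lt continuousAt_const (by simp))
  filter_upwards [hball, self_mem_nhdsWithin] with t ht ht0 l h
  have e : a * bPar q a e₁ j t * c * dPar q c e₂ j t * q ^ l =
      q ^ ((-(j : ℝ) + e₁ * t) + (-(j : ℝ) + 1 + e₂ * t) + (l : ℝ)) := by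
    rw [Real.rpow_add hq0 _ (l : ℝ), Real.rpow_add hq0 (-(j : ℝ) + e₁ * t), Real.rpow_intCast,
      bPar, dPar]
    field_simp
  rw [e] at h
  have h2 := congrArg Real.log h
  rw [Real.log_rpow hq0, Real.log_one, mul_eq_zero] at h2
  have h3 := h2.resolve_right (Real.log_neg hq0 hq1).ne
  have h4 : t = ((2 * j - 1 - l : ℤ) : ℝ) := by
    push_cast
    linear_combination h3 - t * he
  rw [h4] at ht
  rw [← Int.cast_abs] at ht
  have h5 : |(2 * j - 1 - l : ℤ)| < 1 := by exact_mod_cast ht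
  rw [Int.abs_lt_one_iff] at h5
  apply ht0
  rw [h4, h5]
  simp

/-! ### Factorization of the polynomials of degree `j`, `j + 1` and `2j + 1` -/

/-- With `e₁ = 0`, `e₂ = 1` the relation `ab = q^{-j}` holds for every `t`, so the Askey-Wilson
polynomial of degree `j + 1` is constant in `t` and equals its limit. -/
theorem recPoly_alpha_zero {q a c : ℝ} (hq0 : 0 < q) (hq1 : q < 1) (ha : a ≠ 0) (hc : c ≠ 0)
    (j : ℕ) : recPoly (bCoef q a c j) (uCoef q a c 0 j) (j + 1) =
      ∏ s ∈ range (j + 1), (X - C (lattice q a s)) := by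
  refine Polynomial.funext fun x => ?_
  have hlim := tendsto_recPoly_eval (m := j + 1)
    (fun n _ => tendsto_awDiag (e₁ := 0) (e₂ := 1) (α := 0) hq0 hq1 ha hc (by simp) (by simp) j n)
    (fun n hn _ => tendsto_awOff (e₁ := 0) (e₂ := 1) (α := 0) hq0 hq1 ha hc (by simp) (by simp)
      j n hn) x
  refine tendsto_nhds_unique hlim (tendsto_const_nhds.congr' ?_)
  filter_upwards [aw_generic hq0 hq1 ha hc (zero_add 1) j] with t ht
  rw [← aw_truncation hq0.ne' _ c _ j a ha ht]
  rw [bPar_eq hq0]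
  simp only [zero_mul, Real.rpow_zero]
  field_simp

/-- Degree `j` involves only `u_1, …, u_{j-1}`, so `α` may be set to `1`. Then `e₂ = 0` and `cd =
q^{-(j-1)}` for every `t`, and truncation applies with the two parameter pairs exchanged. -/
theorem recPoly_half {q a c : ℝ} (hq0 : 0 < q) (hq1 : q < 1) (ha : a ≠ 0) (hc : c ≠ 0)
    (α : ℝ) (j : ℕ) (hj : 1 ≤ j) : recPoly (bCoef q a c j) (uCoef q a c α j) j =
      ∏ s ∈ range j, (X - C (lattice q c s)) := by
  obtain ⟨m, rfl⟩ : ∃ m, j = m + 1 := ⟨j - 1, by omega⟩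
  have hα : recPoly (bCoef q a c (m + 1)) (uCoef q a c α (m + 1)) (m + 1) =
      recPoly (bCoef q a c (m + 1)) (uCoef q a c 1 (m + 1)) (m + 1) := by
    refine recPoly_congr (fun _ _ => rfl) fun n _ hn => ?_
    rw [uCoef, uCoef, if_neg (by omega), if_neg (by omega), if_neg (by omega), if_neg (by omega)]
  rw [hα]
  refine Polynomial.funext fun x => ?_
  have hlim := tendsto_recPoly_eval (m := m + 1)
    (fun n _ => tendsto_awDiag (e₁ := 1) (e₂ := 0) (α := 1) hq0 hq1 ha hc (by simp) (by simp)
      (m + 1) n)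
    (fun n hn _ => tendsto_awOff (e₁ := 1) (e₂ := 0) (α := 1) hq0 hq1 ha hc (by simp) (by simp)
      (m + 1) n hn) x
  refine tendsto_nhds_unique hlim (tendsto_const_nhds.congr' ?_)
  filter_upwards [aw_generic hq0 hq1 ha hc (add_zero 1) (m + 1)] with t ht
  have h := aw_truncation hq0.ne' (dPar q c 0 (m + 1) t) a (bPar q a 1 (m + 1) t) m c hc
    (fun l => by convert ht l using 1; ring) (by
      rw [dPar_eq hq0]
      simp only [zero_mul, Real.rpow_zero]
      field_simp
      rw [pow_succ, mul_comm])
  rw [← h]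
  congr 1
  refine recPoly_congr (fun n _ => aw_swap_diag hq0.ne' ha hc ht n) fun n hn _ => ?_
  obtain ⟨n, rfl⟩ : ∃ i, n = i + 1 := ⟨n - 1, by omega⟩
  exact aw_swap_off hq0.ne' ha hc n

theorem recPoly_alpha_succ (q a c α : ℝ) (j : ℕ) (hj : 1 ≤ j) :
    recPoly (bCoef q a c j) (uCoef q a c α j) (j + 1) =
      recPoly (bCoef q a c j) (uCoef q a c 0 j) (j + 1)
        + C (α * uMid q a c j) * recPoly (bCoef q a c j) (uCoef q a c α j) (j - 1) := by
  obtain ⟨m, rfl⟩ : ∃ m, j = m + 1 := ⟨j - 1, by omega⟩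
  have hu : ∀ n, 1 ≤ n → n < m + 1 → uCoef q a c α (m + 1) n = uCoef q a c 0 (m + 1) n := by
    intro n _ hn
    rw [uCoef, uCoef, if_neg (by omega), if_neg (by omega), if_neg (by omega), if_neg (by omega)]
  have h1 := recPoly_congr (b := bCoef q a c (m + 1)) (fun _ _ => rfl) hu
  have h2 := recPoly_congr (m := m) (b := bCoef q a c (m + 1)) (fun _ _ => rfl)
    fun n hn hn' => hu n hn (by omega)
  have hm : ∀ β, uCoef q a c β (m + 1) (m + 1) = (1 - β) * uMid q a c (m + 1) :=
    fun β => by rw [uCoef, if_pos rfl]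
  rw [recPoly_add_two, recPoly_add_two, h1, h2, Nat.add_sub_cancel,
    hm, hm, h2]
  simp only [C_mul, C_sub, C_1, C_0]
  ring

/-- Replacing `q^n` by `q^{2j-n}` exchanges the roles of `limA` and `limC`. -/
theorem bCoef_mirror {q : ℝ} (hq0 : 0 < q) (hq1 : q < 1) {a c : ℝ} (ha : a ≠ 0) (hc : c ≠ 0)
    (j n : ℕ) (hn : n ≤ j) : bCoef q a c j (2 * j - n) = bCoef q a c j n := by
  obtain ⟨i, rfl⟩ : ∃ i, j = n + i := ⟨j - n, by omega⟩
  rw [show 2 * (n + i) - n = n + i + i by omega, bCoef_eq_lim hq0 hq1 ha hc,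
    bCoef_eq_lim hq0 hq1 ha hc]
  have h1 := (lim_denom_ne_zero hq0 hq1 0 i).1
  have h2 := (lim_denom_ne_zero hq0 hq1 0 i).2
  have hr : 0 < q ^ n := pow_pos hq0 _
  have hp : 0 < q ^ i := pow_pos hq0 _
  simp only [limA, limC, pow_add, pow_zero, one_pow, mul_one] at *
  generalize q ^ n = r at *
  generalize q ^ i = p at *
  rw [show (r * p) ^ 2 - q * (r * p * p) ^ 2 = r ^ 2 * p ^ 2 * (1 - q * p ^ 2) by ring,
    show q * (r * p) ^ 2 - (r * p * p) ^ 2 = r ^ 2 * p ^ 2 * (q - p ^ 2) by ring,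
    show (r * p) ^ 2 - q * r ^ 2 = -(r ^ 2 * (q - p ^ 2)) by ring,
    show q * (r * p) ^ 2 - r ^ 2 = -(r ^ 2 * (1 - q * p ^ 2)) by ring,
    show r * p + r * p * p = r * p * (1 + p) by ring, show r * p + r = r * (1 + p) by ring]
  generalize h1e : 1 - q * p ^ 2 = D₁ at *
  generalize h2e : q - p ^ 2 = D₂ at *
  field_simp
  rw [← h1e, ← h2e]
  ring

/-- The central pair `u_j, u_{j+1}`, which carries the split into `1 - α` and `α`, is excluded. -/
theorem uCoef_mirror {q : ℝ} (hq0 : 0 < q) (a c α : ℝ) (j n : ℕ) (hn : n < j) :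
    uCoef q a c α j (2 * j + 1 - n) = uCoef q a c α j n := by
  obtain ⟨i, rfl⟩ : ∃ i, j = n + i := ⟨j - n, by omega⟩
  rw [show 2 * (n + i) + 1 - n = n + i + i + 1 by omega, uCoef, uCoef, if_neg (by omega),
    if_neg (by omega), if_neg (by omega), if_neg (by omega)]
  have hr : 0 < q ^ n := pow_pos hq0 _
  have hp : 0 < q ^ i := pow_pos hq0 _
  have e2 : ∀ k, q ^ (2 * k) = (q ^ k) ^ 2 := fun k => by rw [pow_mul']
  have e3 : ∀ k, q ^ (2 * k + 1) = q * (q ^ k) ^ 2 := fun k => by rw [pow_succ, e2]; ring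
  rw [e3, e2, e2, e2, pow_succ q (n + i + i), pow_succ q (n + i), pow_add q (n + i), pow_add q n]
  generalize q ^ n = r at *
  generalize q ^ i = p at *
  -- The common factor by which numerator and denominator grow under the reflection.
  have hz : q ^ 3 * p ^ 6 ≠ 0 := by positivity
  rw [← mul_div_mul_left _ (4 * a ^ 2 * c ^ 2 * (r * p + r) * (r * p * q + r)
    * (q * (r * p) ^ 2 - r ^ 2) ^ 2) hz]
  congr 1 <;> ring

theorem recPoly_full {q a c : ℝ} (hq0 : 0 < q) (hq1 : q < 1) (ha : a ≠ 0) (hc : c ≠ 0)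
    (α : ℝ) (j : ℕ) (hj : 1 ≤ j) : recPoly (bCoef q a c j) (uCoef q a c α j) (2 * j + 1) =
      (∏ s ∈ range j, (X - C (lattice q c s))) * ∏ s ∈ range (j + 1), (X - C (lattice q a s)) := by
  -- Cutting at `k = j - 1` makes `P_j` a factor of both terms; the cofactor `P_{j+1} - αμ P_{j-1}`
  -- is `P_{j+1}` at `α = 0`.
  have h := recPoly_mirror (b := bCoef q a c j) (u := uCoef q a c α j) (j := j)
    (fun n hn => bCoef_mirror hq0 hq1 ha hc j n hn.le)
    (fun n _ hn => uCoef_mirror hq0 a c α j n hn) (j - 1) (by omega)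
  have hs := recPoly_alpha_succ q a c α j hj
  rw [recPoly_alpha_zero hq0 hq1 ha hc] at hs
  have hu : uCoef q a c α j (j + 1) = α * uMid q a c j := by
    rw [uCoef, if_neg (by omega), if_pos rfl]
  rw [show 2 * j - (j - 1) = j + 1 by omega, Nat.sub_add_cancel hj, Nat.add_sub_cancel, hs, hu,
    recPoly_half hq0 hq1 ha hc α j hj] at h
  rw [h]
  ring

/-! ### The bi-lattice and the characteristic polynomial -/

theorem lattice_eq_iff {q : ℝ} (hq0 : 0 < q) {z w : ℝ} (hz : z ≠ 0) (hw : w ≠ 0)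
    (s r : ℕ) : lattice q z s = lattice q w r ↔
      z * q ^ s = w * q ^ r ∨ z * w * q ^ (s + r) = 1 := by
  have hs : 0 < q ^ s := pow_pos hq0 _
  have hr : 0 < q ^ r := pow_pos hq0 _
  have e : lattice q z s - lattice q w r = (w * q ^ r - z * q ^ s) * (1 - z * w * q ^ (s + r)) /
      (2 * z * w * q ^ s * q ^ r) := by
    rw [lattice, lattice, zpow_neg, zpow_neg, zpow_natCast, zpow_natCast, pow_add]
    field_simp
    ring
  rw [← sub_eq_zero, e, div_eq_zero_iff, mul_eq_zero]
  constructor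
  · rintro ((h | h) | h)
    · left; linarith
    · right; linarith
    · exact absurd h (by positivity)
  · rintro (h | h)
    · left; left; linarith
    · left; right; linarith

theorem node_even (q a c : ℝ) (s : ℕ) : node q a c (2 * s) = lattice q a s := by
  rw [node, if_pos (even_two_mul s), Nat.mul_div_cancel_left _ two_pos]

theorem node_odd (q a c : ℝ) (s : ℕ) : node q a c (2 * s + 1) = lattice q c s := by
  rw [node, if_neg (by simp), show (2 * s + 1) / 2 = s by omega]

theorem weight_even (q a c α : ℝ) (j s : ℕ) :
    weight q a c α j (2 * s) = weightEven q a c α j s := by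
  rw [weight, if_pos (even_two_mul s), Nat.mul_div_cancel_left _ two_pos]

theorem weight_odd (q a c α : ℝ) (j s : ℕ) :
    weight q a c α j (2 * s + 1) = weightOdd q a c α j s := by
  rw [weight, if_neg (by simp), show (2 * s + 1) / 2 = s by omega]

theorem sum_range_two_mul_add_one (f : ℕ → ℝ) (j : ℕ) : ∑ s ∈ range (2 * j + 1), f s =
    ∑ s ∈ range (j + 1), f (2 * s) + ∑ s ∈ range j, f (2 * s + 1) := by
  induction j with
  | zero => simp
  | succ j ih =>
    rw [show 2 * (j + 1) + 1 = 2 * j + 1 + 1 + 1 by ring, sum_range_succ, sum_range_succ, ih,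
      sum_range_succ (fun s => f (2 * s)) (j + 1), sum_range_succ (fun s => f (2 * s + 1)) j,
      show 2 * (j + 1) = 2 * j + 1 + 1 by ring]
    ring

theorem prod_range_two_mul_add_one {M : Type*} [CommMonoid M] (f : ℕ → M) (j : ℕ) :
    ∏ s ∈ range (2 * j + 1), f s =
    (∏ s ∈ range (j + 1), f (2 * s)) * ∏ s ∈ range j, f (2 * s + 1) := by
  induction j with
  | zero => simp
  | succ j ih =>
    rw [show 2 * (j + 1) + 1 = 2 * j + 1 + 1 + 1 by ring, prod_range_succ, prod_range_succ, ih,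
      prod_range_succ (fun s => f (2 * s)) (j + 1), prod_range_succ (fun s => f (2 * s + 1)) j,
      show 2 * (j + 1) = 2 * j + 1 + 1 by ring]
    generalize f (2 * j + 1 + 1) = x
    generalize f (2 * j + 1) = y
    ac_rfl

theorem recPoly_full_node {q a c : ℝ} (hq0 : 0 < q) (hq1 : q < 1) (ha : a ≠ 0) (hc : c ≠ 0)
    (α : ℝ) (j : ℕ) (hj : 1 ≤ j) : recPoly (bCoef q a c j) (uCoef q a c α j) (2 * j + 1) =
      ∏ s ∈ range (2 * j + 1), (X - C (node q a c s)) := by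
  rw [recPoly_full hq0 hq1 ha hc α j hj, prod_range_two_mul_add_one, mul_comm]
  simp only [node_even, node_odd]

/-- Factor by factor, `(1 - aq^s e^{iθ})(1 - aq^s e^{-iθ}) = -2aq^s (cos θ - lattice q a s)`. -/
theorem qPoch_exp (a q : ℝ) (hq : q ≠ 0) (ha : a ≠ 0) (n : ℕ) (θ : ℂ) :
    qPoch ((a : ℂ) * Complex.exp (Complex.I * θ)) (q : ℂ) n
      * qPoch ((a : ℂ) * Complex.exp (-(Complex.I * θ))) (q : ℂ) n =
    ((∏ s ∈ range n, (-2 * a * q ^ s) : ℝ) : ℂ)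
      * aeval (Complex.cos θ) (∏ s ∈ range n, (X - C (lattice q a s)) : ℝ[X]) := by
  rw [qPoch, qPoch, ← prod_mul_distrib, map_prod, Complex.ofReal_prod, ← prod_mul_distrib]
  refine prod_congr rfl fun s _ => ?_
  have hqC : (q : ℂ) ^ s ≠ 0 := pow_ne_zero _ (Complex.ofReal_ne_zero.2 hq)
  have haC : (a : ℂ) ≠ 0 := Complex.ofReal_ne_zero.2 ha
  have hE : Complex.exp (Complex.I * θ) * Complex.exp (-(Complex.I * θ)) = 1 := by
    rw [← Complex.exp_add, add_neg_cancel, Complex.exp_zero]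
  have hcos : Complex.cos θ =
      (Complex.exp (Complex.I * θ) + Complex.exp (-(Complex.I * θ))) / 2 := by
    rw [Complex.cos, mul_comm, neg_mul, mul_comm θ]
  simp only [map_sub, aeval_X, aeval_C, lattice, Complex.coe_algebraMap]
  rw [hcos]
  push_cast
  rw [zpow_neg, zpow_natCast]
  generalize Complex.exp (Complex.I * θ) = x at *
  generalize Complex.exp (-(Complex.I * θ)) = y at *
  field_simp
  linear_combination (a : ℂ) ^ 2 * ((q : ℂ) ^ s) ^ 2 * hE

theorem recPoly_full_characteristic {q a c : ℝ} (hq0 : 0 < q) (hq1 : q < 1) (ha : a ≠ 0)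
    (hc : c ≠ 0) (α : ℝ) (j : ℕ) (hj : 1 ≤ j) : ∃ κ : ℝ, κ ≠ 0 ∧ ∀ θ : ℂ,
      aeval (Complex.cos θ) (recPoly (bCoef q a c j) (uCoef q a c α j) (2 * j + 1)) =
        (κ : ℂ) * (qPoch ((a : ℂ) * Complex.exp (Complex.I * θ)) (q : ℂ) (j + 1)
            * qPoch ((a : ℂ) * Complex.exp (-(Complex.I * θ))) (q : ℂ) (j + 1)
            * (qPoch ((c : ℂ) * Complex.exp (Complex.I * θ)) (q : ℂ) j
              * qPoch ((c : ℂ) * Complex.exp (-(Complex.I * θ))) (q : ℂ) j)) := by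
  have hne : ∀ z : ℝ, z ≠ 0 → ∀ n, (∏ s ∈ range n, (-2 * z * q ^ s)) ≠ 0 := fun z hz n =>
    prod_ne_zero_iff.2 fun s _ =>
      mul_ne_zero (mul_ne_zero (by norm_num) hz) (pow_ne_zero _ hq0.ne')
  refine ⟨((∏ s ∈ range (j + 1), (-2 * a * q ^ s)) * ∏ s ∈ range j, (-2 * c * q ^ s))⁻¹,
    inv_ne_zero (mul_ne_zero (hne a ha _) (hne c hc _)), fun θ => ?_⟩
  rw [qPoch_exp a q hq0.ne' ha, qPoch_exp c q hq0.ne' hc, recPoly_full hq0 hq1 ha hc α j hj, map_mul]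
  have h1 := Complex.ofReal_ne_zero.2 (hne a ha (j + 1))
  have h2 := Complex.ofReal_ne_zero.2 (hne c hc j)
  have key : ∀ k₁ k₂ x y : ℂ, k₁ ≠ 0 → k₂ ≠ 0 → y * x = (k₁ * k₂)⁻¹ * (k₁ * x * (k₂ * y)) := by
    intros; field_simp
  rw [Complex.ofReal_inv, Complex.ofReal_mul]
  exact key _ _ _ _ h1 h2

/-! ### The mixture of two quadratures -/

/-- If the chain with coefficients `v` arises from the one with coefficients `u` by splitting `u_j`
into `(1 - α) u_j` and `α u_j`, its orthogonality functional is the mixture of the quadrature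
functionals at the zeros of `P_{j+1}` and of `P_j`. -/
theorem recPoly_mixture {b u v y z : ℕ → ℝ} {k : ℕ} {α : ℝ}
    (hv : ∀ n, 1 ≤ n → n < k + 1 → v n = u n) (hv0 : v (k + 1) = (1 - α) * u (k + 1))
    (hu : ∀ n, 1 ≤ n → n ≤ k + 1 → u n ≠ 0)
    (hy : Set.InjOn y (range (k + 2))) (hz : Set.InjOn z (range (k + 1)))
    (hPy : recPoly b u (k + 2) = ∏ s ∈ range (k + 2), (X - C (y s)))
    (hPz : recPoly b u (k + 1) = ∏ s ∈ range (k + 1), (X - C (z s))) {n : ℕ}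
    (hn : n ≤ 2 * (k + 1)) :
    ∑ s ∈ range (k + 2), (1 - α) * ((∏ i ∈ Icc 1 (k + 1), u i) /
        ((recPoly b u (k + 1)).eval (y s) * ∏ r ∈ (range (k + 2)).erase s, (y s - y r)))
          * (recPoly b v n).eval (y s)
      + ∑ s ∈ range (k + 1), α * (-(∏ i ∈ Icc 1 (k + 1), u i) /
        ((recPoly b u (k + 2)).eval (z s) * ∏ r ∈ (range (k + 1)).erase s, (z s - z r)))
          * (recPoly b v n).eval (z s) = if n = 0 then 1 else 0 := by
  set P := recPoly b u with hP
  set V := recPoly b v with hV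
  have hVP : ∀ n ≤ k + 1, V n = P n := fun n hn =>
    recPoly_congr (fun _ _ => rfl) fun i h1 h2 => hv i h1 (by omega)
  have hP2 : P (k + 2) = (X - C (b (k + 1))) * P (k + 1) - C (u (k + 1)) * P k :=
    recPoly_add_two b u k
  have hVk : V (k + 2) = P (k + 2) + C (α * u (k + 1)) * P k := by
    rw [hP2, hV, recPoly_add_two, ← hV, hVP _ le_rfl, hVP k (by omega), hv0]
    simp only [C_mul, C_sub, C_1]
    ring
  have hz0 : ∀ s ∈ range (k + 1), (P (k + 1)).eval (z s) = 0 := fun s hs => by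
    rw [hPz, eval_prod]; exact prod_eq_zero hs (by simp)
  have hy0 : ∀ s ∈ range (k + 2), (P (k + 2)).eval (y s) = 0 := fun s hs => by
    rw [hPy, eval_prod]; exact prod_eq_zero hs (by simp)
  have hzk : ∀ s ∈ range (k + 1), (P (k + 2)).eval (z s) = -(u (k + 1) * (P k).eval (z s)) := by
    intro s hs
    rw [hP2, eval_sub, eval_mul, hz0 s hs, eval_mul, eval_C]; ring
  have huk := hu (k + 1) (by omega) le_rfl
  set lam : ℕ → ℝ := fun s => (∏ i ∈ Icc 1 (k + 1), u i) /
    ((P (k + 1)).eval (y s) * ∏ r ∈ (range (k + 2)).erase s, (y s - y r)) with hlam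
  set nu : ℕ → ℝ := fun s => -(∏ i ∈ Icc 1 (k + 1), u i) /
    ((P (k + 2)).eval (z s) * ∏ r ∈ (range (k + 1)).erase s, (z s - z r)) with hnu
  -- On the zeros of `P_{k+1}` one has `P_{k+2} = -u_{k+1} P_k`, so these are the ordinary Gauss
  -- weights one level lower; this explains the minus sign in the statement.
  have hnu' : ∀ s ∈ range (k + 1), nu s = (∏ i ∈ Icc 1 k, u i) /
      ((P k).eval (z s) * ∏ r ∈ (range (k + 1)).erase s, (z s - z r)) := by
    intro s hs
    simp only [hnu]
    rw [hzk s hs, prod_Icc_succ_top (by omega), neg_mul, neg_div_neg_eq, mul_comm (∏ i ∈ _, _),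
      mul_assoc, mul_div_mul_left _ _ huk]
  have qy : ∀ n ≤ k + 1, ∀ p : ℝ[X], p.natDegree ≤ n → ∑ s ∈ range (k + 2), lam s
      * ((P n).eval (y s) * p.eval (y s)) = (∏ i ∈ Icc 1 n, u i) * p.coeff n :=
    fun n hn p hp => recPoly_quadrature hu hy hPy hn p hp
  have qz : ∀ n ≤ k, ∀ p : ℝ[X], p.natDegree ≤ n → ∑ s ∈ range (k + 1), nu s
      * ((P n).eval (z s) * p.eval (z s)) = (∏ i ∈ Icc 1 n, u i) * p.coeff n := by
    intro n hn p hp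
    rw [← recPoly_quadrature (fun n h1 h2 => hu n h1 (by omega)) hz hPz hn p hp]
    exact sum_congr rfl fun s hs => by rw [hnu' s hs]
  set L : ℝ[X] → ℝ := fun p => ∑ s ∈ range (k + 2), (1 - α) * lam s * p.eval (y s)
    + ∑ s ∈ range (k + 1), α * nu s * p.eval (z s) with hL
  have hLm : ∀ p r : ℝ[X], L (p * r) = (1 - α) * ∑ s ∈ range (k + 2), lam s
      * (p.eval (y s) * r.eval (y s)) + α * ∑ s ∈ range (k + 1), nu s
      * (p.eval (z s) * r.eval (z s)) := by
    intro p r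
    simp only [hL, eval_mul, mul_sum, mul_assoc]
  have hLsub : ∀ p r : ℝ[X], L (p - r) = L p - L r := by
    intro p r
    simp only [hL, eval_sub, mul_sub, sum_sub_distrib]
    ring
  have hLC : ∀ (t : ℝ) (p : ℝ[X]), L (C t * p) = t * L p := by
    intro t p
    simp only [hL, eval_mul, eval_C, mul_add, mul_sum]
    congr 1 <;> exact sum_congr rfl fun s _ => by ring
  change L (V n) = _
  -- The range of test polynomials shrinks by one degree per step beyond `i = 1`. With `p = 1` it
  -- lasts exactly up to index `2(k + 1)`.
  have high : ∀ i, ∀ p : ℝ[X], p.natDegree + i ≤ k + 1 → p.natDegree ≤ k →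
      L (V (k + 1 + i) * p) = 0 := by
    intro i
    induction i using Nat.twoStepInduction with
    | zero =>
      intro p _ hp
      rw [add_zero, hLm, hVP _ le_rfl, qy (k + 1) le_rfl p (by omega),
        coeff_eq_zero_of_natDegree_lt (by omega), sum_eq_zero fun s hs => by rw [hz0 s hs]; ring]
      ring
    | one =>
      intro p _ hp
      -- On the first node set `V_{k+2}` is `α u_{k+1} P_k`, on the second `(α - 1) u_{k+1} P_k`.
      -- Weighted by `1 - α` and `α` the two contributions cancel.
      have e1 : ∑ s ∈ range (k + 2), lam s * ((V (k + 2)).eval (y s) * p.eval (y s)) =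
          α * u (k + 1) * ((∏ i ∈ Icc 1 k, u i) * p.coeff k) := by
        rw [← qy k (by omega) p hp, mul_sum]
        refine sum_congr rfl fun s hs => ?_
        rw [hVk, eval_add, hy0 s hs, eval_mul, eval_C]; ring
      have e2 : ∑ s ∈ range (k + 1), nu s * ((V (k + 2)).eval (z s) * p.eval (z s)) =
          (α - 1) * u (k + 1) * ((∏ i ∈ Icc 1 k, u i) * p.coeff k) := by
        rw [← qz k le_rfl p hp, mul_sum]
        refine sum_congr rfl fun s hs => ?_
        rw [hVk, eval_add, hzk s hs, eval_mul, eval_C]; ring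
      rw [hLm, e1, e2]
      ring
    | more i ih1 ih2 =>
      intro p hp hp'
      have hd : ((X - C (b (k + 1 + i + 1))) * p).natDegree ≤ p.natDegree + 1 := by
        refine natDegree_mul_le.trans ?_
        rw [natDegree_X_sub_C, add_comm]
      have e : V (k + 1 + (i + 2)) * p = V (k + 1 + (i + 1)) * ((X - C (b (k + 1 + i + 1))) * p)
          - C (v (k + 1 + i + 1)) * (V (k + 1 + i) * p) := by
        rw [hV, show k + 1 + (i + 2) = (k + 1 + i) + 2 by ring, recPoly_add_two]
        ring_nf
      rw [e, hLsub, hLC, ih1 p (by omega) hp', ih2 _ (by omega) (by omega)]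
      ring
  rcases Nat.lt_or_ge k n with h | h
  · obtain ⟨i, rfl⟩ : ∃ i, n = k + 1 + i := ⟨n - (k + 1), by omega⟩
    have := high i 1 (by rw [natDegree_one]; omega) (by rw [natDegree_one]; omega)
    rw [mul_one] at this
    rw [this, if_neg (by omega)]
  · have := hLm (V n) 1
    rw [mul_one, hVP n (by omega), qy n (by omega) 1 (by simp), qz n h 1 (by simp)] at this
    rw [hVP n (by omega), this]
    split_ifs with h0
    · subst h0; simp
    · rw [coeff_one, if_neg (by omega)]; ring

/-! ### Consequences of the points of the bi-lattice being distinct -/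

theorem lattice_ne_of_injOn {q a c : ℝ} {j : ℕ}
    (H : Set.InjOn (node q a c) (Set.Iic (2 * j))) {s r : ℕ} (hs : s ≤ j) (hr : r < j) :
    lattice q a s ≠ lattice q c r := by
  intro h
  rw [← node_even q a c, ← node_odd q a c] at h
  have := H (Set.mem_Iic.2 (by omega)) (Set.mem_Iic.2 (by omega)) h
  omega

theorem injOn_lattice_even {q a c : ℝ} {j : ℕ}
    (H : Set.InjOn (node q a c) (Set.Iic (2 * j))) :
    Set.InjOn (lattice q a) (range (j + 1)) := by
  intro s hs r hr h
  rw [coe_range, Set.mem_Iio] at hs hr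
  rw [← node_even q a c, ← node_even q a c] at h
  have := H (Set.mem_Iic.2 (by omega)) (Set.mem_Iic.2 (by omega)) h
  omega

theorem injOn_lattice_odd {q a c : ℝ} {j : ℕ}
    (H : Set.InjOn (node q a c) (Set.Iic (2 * j))) :
    Set.InjOn (lattice q c) (range j) := by
  intro s hs r hr h
  rw [coe_range, Set.mem_Iio] at hs hr
  rw [← node_odd q a c, ← node_odd q a c] at h
  have := H (Set.mem_Iic.2 (by omega)) (Set.mem_Iic.2 (by omega)) h
  omega

/-- Every `m < 2j` is a sum `s + r` with `s ≤ j` and `r < j`, and `acq^{s+r} = 1` would make an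
`a`-point coincide with a `c`-point. -/
theorem mul_pow_ne_one_of_injOn {q a c : ℝ} (hq0 : 0 < q) (ha : a ≠ 0) (hc : c ≠ 0) {j : ℕ}
    (H : Set.InjOn (node q a c) (Set.Iic (2 * j))) {m : ℕ} (hm : m < 2 * j) :
    a * c * q ^ m ≠ 1 := by
  intro h
  have hs : min m j ≤ j := min_le_right _ _
  have hr : m - min m j < j := by omega
  refine lattice_ne_of_injOn H hs hr ((lattice_eq_iff hq0 ha hc _ _).2 (Or.inr ?_))
  rwa [show min m j + (m - min m j) = m by omega]

theorem mul_pow_ne_right_of_injOn {q a c : ℝ} (hq0 : 0 < q) (ha : a ≠ 0) (hc : c ≠ 0) {j : ℕ}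
    (hj : 1 ≤ j) (H : Set.InjOn (node q a c) (Set.Iic (2 * j))) {m : ℕ} (hm : m ≤ j) :
    a * q ^ m ≠ c := fun h =>
  lattice_ne_of_injOn H hm hj
    ((lattice_eq_iff hq0 ha hc _ _).2 (Or.inl (by rw [h, pow_zero, mul_one])))

theorem mul_pow_ne_left_of_injOn {q a c : ℝ} (hq0 : 0 < q) (ha : a ≠ 0) (hc : c ≠ 0) {j : ℕ}
    (H : Set.InjOn (node q a c) (Set.Iic (2 * j))) {m : ℕ} (hm : m < j) :
    c * q ^ m ≠ a := fun h =>
  lattice_ne_of_injOn H (Nat.zero_le j) hm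
    ((lattice_eq_iff hq0 ha hc _ _).2 (Or.inl (by rw [h, pow_zero, mul_one])))

theorem uMid_ne_zero_of_injOn {q a c : ℝ} (hq0 : 0 < q) (hq1 : q < 1) (ha : a ≠ 0) (hc : c ≠ 0)
    {j : ℕ} (hj : 1 ≤ j) (H : Set.InjOn (node q a c) (Set.Iic (2 * j))) : uMid q a c j ≠ 0 := by
  have hq : ∀ n, n ≠ 0 → q ^ n - 1 ≠ 0 := fun n hn => (sub_neg.2 (pow_lt_one₀ hq0.le hq1 hn)).ne
  have h1 := mul_pow_ne_right_of_injOn hq0 ha hc hj H (Nat.zero_le j)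
  have h2 := mul_pow_ne_right_of_injOn hq0 ha hc hj H hj
  have h3 := mul_pow_ne_one_of_injOn hq0 ha hc H (show j < 2 * j by omega)
  have h4 := mul_pow_ne_one_of_injOn hq0 ha hc H (show j - 1 < 2 * j by omega)
  rw [pow_zero, mul_one] at h1
  rw [pow_one] at h2
  have h4' : a * c * q ^ j - q ≠ 0 := by
    obtain ⟨k, rfl⟩ : ∃ k, j = k + 1 := ⟨j - 1, by omega⟩
    rw [Nat.add_sub_cancel] at h4
    intro h
    apply h4
    have : q * (a * c * q ^ k - 1) = 0 := by rw [← h]; ring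
    linarith [(mul_eq_zero.1 this).resolve_left hq0.ne']
  have hq' : q - 1 ≠ 0 := by linarith
  rw [uMid]
  refine div_ne_zero ?_ (by positivity)
  exact mul_ne_zero (mul_ne_zero (mul_ne_zero (mul_ne_zero (mul_ne_zero (mul_ne_zero
    (sub_ne_zero.2 h1.symm) (zpow_ne_zero _ hq0.ne')) (hq j (by omega))) (hq _ (by omega)))
    (sub_ne_zero.2 h2)) (sub_ne_zero.2 h3)) h4'

/-- Each numerator factor involving `a` and `c` vanishes only if an `a`-point meets a `c`-point; the
remaining factors are differences of distinct powers of `q`. -/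
theorem uCoef_ne_zero_of_injOn {q a c : ℝ} (hq0 : 0 < q) (hq1 : q < 1) (ha : a ≠ 0) (hc : c ≠ 0)
    (α : ℝ) {j n : ℕ} (h1 : 1 ≤ n) (hn : n < j)
    (H : Set.InjOn (node q a c) (Set.Iic (2 * j))) : uCoef q a c α j n ≠ 0 := by
  rw [uCoef, if_neg (by omega), if_neg (by omega)]
  have hq : ∀ n, 0 < q ^ n := fun n => pow_pos hq0 n
  have k1 : q ^ n - 1 ≠ 0 := (sub_neg.2 (pow_lt_one₀ hq0.le hq1 (by omega))).ne
  have k2 : q ^ n - q ^ (2 * j + 1) ≠ 0 :=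
    sub_ne_zero.2 (pow_ne_pow_of_ne hq0 hq1 (by omega))
  have k3 : a * c * q ^ n - q ≠ 0 := by
    obtain ⟨m, rfl⟩ : ∃ m, n = m + 1 := ⟨n - 1, by omega⟩
    intro h
    apply mul_pow_ne_one_of_injOn hq0 ha hc H (show m < 2 * j by omega)
    have : q * (a * c * q ^ m - 1) = 0 := by rw [← h]; ring
    linarith [(mul_eq_zero.1 this).resolve_left hq0.ne']
  have k4 : q ^ n - a * c * q ^ (2 * j) ≠ 0 := by
    obtain ⟨m, hm⟩ : ∃ m, 2 * j = n + m := ⟨2 * j - n, by omega⟩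
    intro h
    apply mul_pow_ne_one_of_injOn hq0 ha hc H (show m < 2 * j by omega)
    have : q ^ n * (a * c * q ^ m - 1) = 0 := by
      rw [hm, pow_add] at h; linear_combination -h
    linarith [(mul_eq_zero.1 this).resolve_left (hq n).ne']
  have k5 : a * q ^ n - c * q ^ j ≠ 0 := by
    obtain ⟨m, rfl⟩ : ∃ m, j = n + m := ⟨j - n, by omega⟩
    intro h
    apply mul_pow_ne_left_of_injOn hq0 ha hc H (show m < n + m by omega)
    have : q ^ n * (c * q ^ m - a) = 0 := by
      rw [pow_add] at h; linear_combination -h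
    linarith [(mul_eq_zero.1 this).resolve_left (hq n).ne']
  have k6 : c * q ^ n - a * q ^ (j + 1) ≠ 0 := by
    obtain ⟨m, hm⟩ : ∃ m, j + 1 = n + m := ⟨j + 1 - n, by omega⟩
    intro h
    apply mul_pow_ne_right_of_injOn hq0 ha hc (by omega) H (show m ≤ j by omega)
    have : q ^ n * (a * q ^ m - c) = 0 := by
      rw [hm, pow_add] at h; linear_combination -h
    linarith [(mul_eq_zero.1 this).resolve_left (hq n).ne']
  have k7 : q ^ (2 * j + 1) - q ^ (2 * n) ≠ 0 :=
    sub_ne_zero.2 (pow_ne_pow_of_ne hq0 hq1 (by omega))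
  have := hq n
  have := hq j
  have := hq (j + 1)
  refine div_ne_zero ?_ (by positivity)
  exact mul_ne_zero (mul_ne_zero (mul_ne_zero (mul_ne_zero (mul_ne_zero k1 k2) k3) k4) k5) k6

/-! ### Products of lattice differences as `q`-Pochhammer symbols -/

theorem prod_pow_mul_prod_pow_succ (q : ℝ) (m : ℕ) :
    (∏ i ∈ range m, q ^ i) * ∏ i ∈ range m, q ^ (i + 1) = q ^ (m ^ 2) := by
  induction m with
  | zero => simp
  | succ m ih =>
    rw [prod_range_succ, prod_range_succ, mul_mul_mul_comm, ih, ← pow_add, ← pow_add]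
    congr 1; ring

theorem lattice_sub_lattice {q z w : ℝ} (hq : q ≠ 0) (hz : z ≠ 0) (hw : w ≠ 0) (s r : ℕ) :
    lattice q z s - lattice q w r =
      (1 - z / w * (q ^ s / q ^ r)) * (1 - z * w * q ^ (s + r)) / (2 * z * q ^ s) := by
  rw [lattice, lattice, zpow_neg, zpow_neg, zpow_natCast, zpow_natCast, pow_add]
  field_simp
  ring

theorem prod_one_sub_div_pow {x q : ℝ} (hq : q ≠ 0) (hx : x ≠ 0) (m : ℕ) :
    ∏ r ∈ range m, (1 - x / q ^ r) = qPoch x⁻¹ q m * (-x) ^ m / ∏ i ∈ range m, q ^ i := by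
  have h : (-x) ^ m = ∏ _i ∈ range m, (-x) := by rw [prod_const, card_range]
  rw [qPoch, h, ← prod_mul_distrib, ← prod_div_distrib]
  refine prod_congr rfl fun r _ => ?_
  field_simp
  ring

theorem qPoch_zpow_eq_prod {q : ℝ} (hq : q ≠ 0) (x : ℝ) (m : ℕ) :
    qPoch (x * q ^ (1 - (m : ℤ))) q m = ∏ r ∈ range m, (1 - x / q ^ r) := by
  rw [qPoch, ← prod_range_reflect]
  refine prod_congr rfl fun r hr => ?_
  rw [mem_range] at hr
  obtain ⟨k, hk⟩ : ∃ k, m = k + 1 + r := ⟨m - 1 - r, by omega⟩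
  rw [show m - 1 - r = k by omega, hk, show (1 - ((k + 1 + r : ℕ) : ℤ)) = -((k + r : ℕ) : ℤ) by
    push_cast; ring, zpow_neg, zpow_natCast, pow_add]
  field_simp

/-- Both sides are `(xq^{1-m};q)_{s+m}`, split after `s` factors on the left and after `m` factors
on the right, where the first `m` factors are then inverted. -/
theorem qPoch_zpow_mul_prod {x q : ℝ} (hq : q ≠ 0) (hx : x ≠ 0) (m s : ℕ) :
    qPoch (x * q ^ (1 - (m : ℤ))) q s * ∏ r ∈ range m, (1 - x * (q ^ s / q ^ r)) =
      qPoch (x * q) q s * qPoch x⁻¹ q m * ((-x) ^ m / ∏ i ∈ range m, q ^ i) := by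
  have h1 : ∏ r ∈ range m, (1 - x * (q ^ s / q ^ r)) =
      qPoch (x * q ^ (1 - (m : ℤ)) * q ^ s) q m := by
    rw [show x * q ^ (1 - (m : ℤ)) * q ^ s = (x * q ^ s) * q ^ (1 - (m : ℤ)) by ring,
      qPoch_zpow_eq_prod hq]
    exact prod_congr rfl fun r _ => by ring
  have h2 : x * q ^ (1 - (m : ℤ)) * q ^ m = x * q := by
    rw [zpow_sub₀ hq, zpow_natCast, zpow_one]; field_simp
  rw [h1, ← qPoch_add, add_comm s m, qPoch_add, h2, qPoch_zpow_eq_prod hq,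
    prod_one_sub_div_pow hq hx]
  ring

/-- The analogue for a lattice against itself, without the vanishing factor. The factors `r < s`
form `(q;q)_s`; those with `r > s` are completed by `(q^{-m};q)_s` to `∏_{i<m} (1 - q^{-(i+1)})`. -/
theorem qPoch_neg_zpow_mul_prod_erase {q : ℝ} (hq : q ≠ 0) (m s : ℕ) (hs : s ≤ m) :
    qPoch (q ^ (-(m : ℤ))) q s * ∏ r ∈ (range (m + 1)).erase s, (1 - q ^ s / q ^ r) =
      qPoch q q s * qPoch q q m * ((-1) ^ m / ∏ i ∈ range m, q ^ (i + 1)) := by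
  have h1 : ∏ r ∈ (range (m + 1)).erase s, (1 - q ^ s / q ^ r) =
      qPoch q q s * ∏ i ∈ range (m - s), (1 - 1 / q ^ (i + 1)) := by
    obtain ⟨d, rfl⟩ : ∃ d, m = s + d := ⟨m - s, by omega⟩
    have hset : (range (s + d + 1)).erase s = range s ∪ (range d).map (addLeftEmbedding (s + 1)) := by
      ext r
      simp only [mem_erase, mem_range, mem_union, Finset.mem_map, addLeftEmbedding_apply]
      constructor
      · rintro ⟨h1, h2⟩
        rcases Nat.lt_or_ge r s with h | h
        · exact Or.inl h
        · exact Or.inr ⟨r - (s + 1), by omega, by omega⟩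
      · rintro (h | ⟨i, h, rfl⟩) <;> omega
    have hdis : Disjoint (range s) ((range d).map (addLeftEmbedding (s + 1))) := by
      rw [Finset.disjoint_left]
      intro r h1 h2
      simp only [mem_range, Finset.mem_map, addLeftEmbedding_apply] at h1 h2
      obtain ⟨i, -, rfl⟩ := h2
      omega
    rw [hset, prod_union hdis, prod_map, Nat.add_sub_cancel_left]
    congr 1
    · rw [qPoch, ← prod_range_reflect]
      refine prod_congr rfl fun r hr => ?_
      rw [mem_range] at hr
      obtain ⟨k, hk⟩ : ∃ k, s = k + 1 + r := ⟨s - 1 - r, by omega⟩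
      rw [show s - 1 - r = k by omega, hk]
      field_simp
      ring
    · refine prod_congr rfl fun i _ => ?_
      rw [addLeftEmbedding_apply, show s + 1 + i = s + (i + 1) by ring, pow_add q s]
      field_simp
  have h2 : qPoch (q ^ (-(m : ℤ))) q s * ∏ i ∈ range (m - s), (1 - 1 / q ^ (i + 1)) =
      ∏ i ∈ range m, (1 - 1 / q ^ (i + 1)) := by
    obtain ⟨d, rfl⟩ : ∃ d, m = s + d := ⟨m - s, by omega⟩
    rw [Nat.add_sub_cancel_left, add_comm s d, prod_range_add, mul_comm]
    congr 1
    rw [qPoch, ← prod_range_reflect]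
    refine prod_congr rfl fun r hr => ?_
    rw [mem_range] at hr
    obtain ⟨k, hk⟩ : ∃ k, s = k + 1 + r := ⟨s - 1 - r, by omega⟩
    rw [show s - 1 - r = k by omega, hk, zpow_neg, zpow_natCast,
      show d + (k + 1 + r) = k + (d + r + 1) by ring, pow_add q k]
    field_simp
  have h3 : ∏ i ∈ range m, (1 - 1 / q ^ (i + 1)) =
      qPoch q q m * ((-1) ^ m / ∏ i ∈ range m, q ^ (i + 1)) := by
    have h : (-1 : ℝ) ^ m = ∏ _i ∈ range m, (-1 : ℝ) := by rw [prod_const, card_range]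
    rw [qPoch, h, ← prod_div_distrib, ← prod_mul_distrib]
    refine prod_congr rfl fun r _ => ?_
    field_simp
    ring
  rw [h1, mul_left_comm, h2, h3]
  ring

theorem prod_lattice_sub {q z w : ℝ} (hq : q ≠ 0) (hz : z ≠ 0) (hw : w ≠ 0) (s m : ℕ) :
    ∏ r ∈ range m, (lattice q z s - lattice q w r) =
      (∏ r ∈ range m, (1 - z / w * (q ^ s / q ^ r))) * qPoch (z * w * q ^ s) q m
        / (2 * z * q ^ s) ^ m := by
  have h : (2 * z * q ^ s) ^ m = ∏ _i ∈ range m, (2 * z * q ^ s) := by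
    rw [prod_const, card_range]
  rw [qPoch, h, ← prod_mul_distrib, ← prod_div_distrib]
  refine prod_congr rfl fun r _ => ?_
  rw [lattice_sub_lattice hq hz hw, pow_add, mul_assoc (z * w)]

theorem prod_erase_lattice_sub {q z : ℝ} (hq : q ≠ 0) (hz : z ≠ 0) (s m : ℕ) (hs : s ≤ m) :
    ∏ r ∈ (range (m + 1)).erase s, (lattice q z s - lattice q z r) =
      (∏ r ∈ (range (m + 1)).erase s, (1 - q ^ s / q ^ r)) * selfProd q (z ^ 2) m s
        / (2 * z * q ^ s) ^ m := by
  have h : (2 * z * q ^ s) ^ m = ∏ _i ∈ (range (m + 1)).erase s, (2 * z * q ^ s) := by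
    rw [prod_const, card_erase_of_mem (mem_range.2 (by omega)), card_range, Nat.add_sub_cancel]
  rw [selfProd, h, ← prod_mul_distrib, ← prod_div_distrib]
  refine prod_congr rfl fun r _ => ?_
  rw [lattice_sub_lattice hq hz hz, div_self hz, one_mul, sq]

/-! ### Identification of the constant and of the weights -/

/-- Each factor is brought to the form `1 - zq^i`, up to powers of `q`, so that the product over `i`
can be read off as `q`-Pochhammer symbols; this feeds `KConst_eq_prod`. -/
theorem uCoef_succ_eq_factors {q a c : ℝ} (hq0 : 0 < q) (ha : a ≠ 0) (hc : c ≠ 0) (α : ℝ)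
    {k i : ℕ} (hi : i < k) : uCoef q a c α (k + 1) (i + 1) =
      q ^ (2 * k + 3) / 4 / (q ^ i * q ^ (i + 1) * q)
        * ((1 - q * q ^ i) * (1 - q ^ (-(2 * (k + 1 : ℕ) : ℤ)) * q ^ i) * (1 - a * c * q ^ i)
          * (1 - q ^ (1 - 2 * ((k + 1 : ℕ) : ℤ)) / (a * c) * q ^ i)
          * (1 - a * q ^ (1 - ((k + 1 : ℕ) : ℤ)) / c * q ^ i)
          * (1 - c * q ^ (-((k + 1 : ℕ) : ℤ)) / a * q ^ i))
        / ((1 + q ^ (k - i)) * (1 + q ^ (k + 1 - i))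
          * (1 - q ^ (-(2 * (k + 1 : ℕ) : ℤ) - 1) * q ^ 2 * (q ^ 2) ^ i) ^ 2) := by
  obtain ⟨d, rfl⟩ : ∃ d, k = i + d := ⟨k - i, by omega⟩
  have hq := hq0.ne'
  rw [uCoef, if_neg (by omega), if_neg (by omega), show i + d - i = d by omega,
    show i + d + 1 - i = d + 1 by omega]
  have z1 : q ^ (-(2 * (i + d + 1 : ℕ) : ℤ)) = (q ^ i * q ^ d * q)⁻¹ ^ 2 := by
    rw [zpow_neg, ← pow_add, ← pow_succ, inv_pow, ← pow_mul']; norm_cast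
  have z2 : q ^ (1 - 2 * ((i + d + 1 : ℕ) : ℤ)) = q * (q ^ i * q ^ d * q)⁻¹ ^ 2 := by
    rw [← z1, ← zpow_one_add₀ hq]; rfl
  have z3 : q ^ (-((i + d + 1 : ℕ) : ℤ)) = (q ^ i * q ^ d * q)⁻¹ := by
    rw [zpow_neg, zpow_natCast, ← pow_add, ← pow_succ]
  have z4 : q ^ (1 - ((i + d + 1 : ℕ) : ℤ)) = q * (q ^ i * q ^ d * q)⁻¹ := by
    rw [← z3, ← zpow_one_add₀ hq]; rfl
  have z5 : q ^ (-(2 * (i + d + 1 : ℕ) : ℤ) - 1) = (q ^ i * q ^ d * q)⁻¹ ^ 2 / q := by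
    rw [← z1, zpow_sub_one₀ hq, div_eq_mul_inv]
  have e1 : q ^ (2 * (i + d + 1)) = (q ^ i * q ^ d * q) ^ 2 := by ring
  have e2 : q ^ (2 * (i + d + 1) + 1) = (q ^ i * q ^ d * q) ^ 2 * q := by
    rw [pow_succ, e1]
  have e3 : q ^ (2 * (i + 1)) = (q ^ i * q) ^ 2 := by ring
  have e4 : q ^ (2 * (i + d) + 3) = (q ^ i * q ^ d * q) ^ 2 * q := by
    rw [← e2]; congr 1
  rw [z1, z2, z3, z4, z5, e1, e2, e3, e4, pow_succ q (i + d + 1), pow_succ q (i + d),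
    pow_succ q i, pow_succ q d, pow_add q i d, pow_right_comm q 2 i]
  have hp : 0 < q ^ i := pow_pos hq0 _
  have hr : 0 < q ^ d := pow_pos hq0 _
  generalize q ^ i = p at *
  generalize q ^ d = r at *
  rw [show 1 - (p * r * q)⁻¹ ^ 2 / q * q ^ 2 * p ^ 2 =
      ((p * r * q) ^ 2 * q - (p * q) ^ 2) / ((p * r * q) ^ 2 * q) by field_simp]
  generalize (p * r * q) ^ 2 * q - (p * q) ^ 2 = D
  -- If `D = 0`, both sides are `0` by the convention for division by zero.
  rcases eq_or_ne D 0 with hD | hD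
  · simp [hD]
  field_simp
  ring

/-- The normalization constant in terms of the recurrence coefficients. -/
theorem KConst_eq_prod {q a c : ℝ} (hq0 : 0 < q) (hq1 : q < 1) (ha : a ≠ 0) (hc : c ≠ 0) (α : ℝ)
    (k : ℕ) : KConst q a c (k + 1) = 4 ^ (k + 1) * q ^ ((k + 1) ^ 2) * (uMid q a c (k + 1)
      * ∏ i ∈ range k, uCoef q a c α (k + 1) (i + 1)) := by
  have hq := hq0.ne'
  have hprod : ∏ i ∈ range k, uCoef q a c α (k + 1) (i + 1) =
      (q ^ (2 * k + 3) / 4) ^ k / (q ^ (k ^ 2) * q ^ k)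
        * (qPoch q q k * qPoch (q ^ (-(2 * (k + 1 : ℕ) : ℤ))) q k * qPoch (a * c) q k
          * qPoch (q ^ (1 - 2 * ((k + 1 : ℕ) : ℤ)) / (a * c)) q k
          * qPoch (a * q ^ (1 - ((k + 1 : ℕ) : ℤ)) / c) q k
          * qPoch (c * q ^ (-((k + 1 : ℕ) : ℤ)) / a) q k)
        / ((∏ i ∈ range k, (1 + q ^ (k - i))) * (∏ i ∈ range k, (1 + q ^ (k + 1 - i)))
          * qPoch (q ^ (-(2 * (k + 1 : ℕ) : ℤ) - 1) * q ^ 2) (q ^ 2) k ^ 2) := by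
    have hconst : ∀ x : ℝ, x ^ k = ∏ _i ∈ range k, x := fun x => by rw [prod_const, card_range]
    rw [prod_congr rfl fun i hi => uCoef_succ_eq_factors hq0 ha hc α (mem_range.1 hi),
      ← prod_pow_mul_prod_pow_succ, hconst q, hconst (_ / 4)]
    simp only [qPoch, ← prod_mul_distrib, ← prod_div_distrib, ← prod_pow]
  have hk1 : ∏ i ∈ range k, (1 + q ^ (k - i)) = qPoch (-q) q k := by
    rw [qPoch, ← prod_range_reflect]
    refine prod_congr rfl fun i hi => ?_
    rw [mem_range] at hi
    rw [show k - (k - 1 - i) = i + 1 by omega]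
    ring
  have hk2 : (1 + q) * ∏ i ∈ range k, (1 + q ^ (k + 1 - i)) = qPoch (-q) q (k + 1) := by
    rw [qPoch_succ_left, sub_neg_eq_add]
    congr 1
    rw [qPoch, ← prod_range_reflect]
    refine prod_congr rfl fun i hi => ?_
    rw [mem_range] at hi
    rw [show k + 1 - (k - 1 - i) = i + 1 + 1 by omega]
    ring
  have s1 : ∀ z : ℝ, ∀ m, qPoch z q (m + 1) = qPoch z q m * (1 - z * q ^ m) := fun z m => by
    rw [qPoch, prod_range_succ, ← qPoch]
  have hk3 := s1 (-q) k
  have hw : 1 - q ≠ 0 := by linarith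
  have hp : 0 < q ^ k := pow_pos hq0 _
  have z0 : q ^ (-(2 * (k + 1 : ℕ) : ℤ) - 1) = ((q ^ k * q) ^ 2 * q)⁻¹ := by
    rw [show (-(2 * (k + 1 : ℕ) : ℤ) - 1) = -((2 * (k + 1) + 1 : ℕ) : ℤ) by push_cast; ring,
      zpow_neg, zpow_natCast]
    congr 1
    ring
  have hL : qPoch (q ^ (-(2 * (k + 1 : ℕ) : ℤ) - 1)) q (k + 1) =
      (1 - ((q ^ k * q) ^ 2 * q)⁻¹) * qPoch (q ^ (-(2 * (k + 1 : ℕ) : ℤ))) q k := by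
    rw [qPoch_succ_left, z0]
    congr 2
    rw [← z0, ← zpow_add_one₀ hq, sub_add_cancel]
  have hM : qPoch (q ^ (-(2 * (k + 1 : ℕ) : ℤ) - 1)) (q ^ 2) (k + 1) =
      (1 - ((q ^ k * q) ^ 2 * q)⁻¹) * qPoch (q ^ (-(2 * (k + 1 : ℕ) : ℤ) - 1) * q ^ 2) (q ^ 2) k := by
    rw [qPoch_succ_left, z0]
  have z6 : q ^ (2 * ((k + 1 : ℕ) : ℤ) ^ 2 - 4 * ((k + 1 : ℕ) : ℤ) - 1) =
      q ^ (2 * k ^ 2) / q ^ 3 := by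
    rw [← zpow_natCast q (2 * k ^ 2), ← zpow_natCast q 3, ← zpow_sub₀ hq]
    congr 1; push_cast; ring
  have z7 : q ^ (-(2 * ((k + 1 : ℕ) : ℤ))) = ((q ^ k * q) ^ 2)⁻¹ := by
    rw [zpow_neg, ← pow_succ, ← pow_mul']; norm_cast
  have e1 : q ^ ((k + 1) ^ 2) = q ^ (k ^ 2) * (q ^ k) ^ 2 * q := by
    rw [← pow_mul, ← pow_add, ← pow_succ]; congr 1; ring
  have e2 : (q ^ (2 * k + 3) / 4) ^ k = q ^ (k ^ 2) * q ^ (k ^ 2) * (q ^ k) ^ 3 / 4 ^ k := by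
    rw [div_pow, ← pow_mul, ← pow_mul, ← pow_add, ← pow_add]; congr 2; ring
  have e3 : q ^ (2 * k ^ 2) = q ^ (k ^ 2) * q ^ (k ^ 2) := by
    rw [← pow_add]; congr 1; ring
  have e4 : q ^ (2 * (k + 1) + 1) = (q ^ k * q) ^ 2 * q := by ring
  have hB : 0 < ∏ i ∈ range k, (1 + q ^ (k + 1 - i)) := prod_pos fun i _ => by positivity
  have hm : 1 - (q ^ k * q) ^ 2 * q ≠ 0 := by
    rw [← e4]
    exact (sub_pos.2 (pow_lt_one₀ hq0.le hq1 (by omega))).ne'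
  have hm' : 1 - ((q ^ k * q) ^ 2 * q)⁻¹ =
      -(1 - (q ^ k * q) ^ 2 * q) / ((q ^ k * q) ^ 2 * q) := by
    field_simp; ring
  rw [hm'] at hL hM
  have hD : qPoch (-q) q k = (1 + q) * (∏ i ∈ range k, (1 + q ^ (k + 1 - i))) / (1 + q * q ^ k) := by
    rw [eq_div_iff (by positivity), hk2, hk3]; ring
  rw [hprod, hk1, KConst, uMid, hL, hM, z6, e1, e2, e3, e4, s1 q k, s1 (a * c) (k + 1),
    s1 (a * c) k, Nat.add_sub_cancel, ← hk2, hD]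
  generalize ∏ i ∈ range k, (1 + q ^ (k + 1 - i)) = B at *
  generalize qPoch (q ^ (-(2 * (k + 1 : ℕ) : ℤ) - 1) * q ^ 2) (q ^ 2) k = M at *
  generalize qPoch (q ^ (-(2 * (k + 1 : ℕ) : ℤ))) q k = A₁ at *
  generalize qPoch (q ^ (1 - 2 * ((k + 1 : ℕ) : ℤ)) / (a * c)) q k = A₂ at *
  generalize qPoch (a * q ^ (1 - ((k + 1 : ℕ) : ℤ)) / c) q k = A₃ at *
  generalize qPoch (c * q ^ (-((k + 1 : ℕ) : ℤ)) / a) q k = A₄ at *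
  generalize qPoch q q k = A₅ at *
  generalize qPoch (a * c) q k = A₆ at *
  rw [z7, show q ^ (k + 1 + 1) = q ^ k * q * q by ring, pow_succ q k, pow_succ (4 : ℝ) k]
  have hT : 0 < q ^ (k ^ 2) := pow_pos hq0 _
  clear hL hM z0 z6 z7 e1 e2 e3 e4 hD hk1 hk2 hk3 hprod hm' s1
  generalize q ^ (k ^ 2) = T at *
  generalize q ^ k = p at *
  generalize hme : 1 - (p * q) ^ 2 * q = m at *
  rw [show (q - 1) ^ 2 = (1 - q) ^ 2 by ring]
  generalize hwe : 1 - q = w at *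
  rcases eq_or_ne M 0 with hM | hM
  · simp [hM]
  field_simp
  ring

/-- Cancellation scheme common to both families of weights. -/
theorem weight_cancel {P₁ P₂ P₃ Q₁ Q₂ Q₃ Q₄ Q₅ Q₆ E F G S σ₁ σ₂ W V K h : ℝ}
    (h1 : P₁ * E = Q₄ * Q₁ * σ₁) (h2 : P₂ * F = Q₅ * Q₂ * σ₂) (h3 : P₃ * G = Q₃ * Q₆)
    (hQ₁ : Q₁ ≠ 0) (hQ₂ : Q₂ ≠ 0) (hQ₃ : Q₃ ≠ 0) (hQ₄ : Q₄ ≠ 0) (hQ₅ : Q₅ ≠ 0) (hQ₆ : Q₆ ≠ 0)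
    (hσ₁ : σ₁ ≠ 0) (hσ₂ : σ₂ ≠ 0) (hW : W ≠ 0) (hV : V ≠ 0) (hK : K * σ₁ * σ₂ = h * V * W) :
    K * P₁ * P₃ * P₂ / (Q₁ * Q₂ * Q₃ * S * Q₄ * Q₅ * Q₆) =
      h / (F * G / V * (E * S / W)) := by
  have hE : E ≠ 0 := by
    rintro rfl; rw [mul_zero] at h1
    exact mul_ne_zero (mul_ne_zero hQ₄ hQ₁) hσ₁ h1.symm
  have hF : F ≠ 0 := by
    rintro rfl; rw [mul_zero] at h2
    exact mul_ne_zero (mul_ne_zero hQ₅ hQ₂) hσ₂ h2.symm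
  have hG : G ≠ 0 := by
    rintro rfl; rw [mul_zero] at h3
    exact mul_ne_zero hQ₃ hQ₆ h3.symm
  have e1 : P₁ = Q₄ * Q₁ * σ₁ / E := (eq_div_iff hE).2 h1
  have e2 : P₂ = Q₅ * Q₂ * σ₂ / F := (eq_div_iff hF).2 h2
  have e3 : P₃ = Q₃ * Q₆ / G := (eq_div_iff hG).2 h3
  have eh : h = K * σ₁ * σ₂ / (V * W) := by
    rw [hK, mul_assoc, mul_div_cancel_right₀ _ (mul_ne_zero hV hW)]
  rw [e1, e2, e3, eh]
  -- `S` occurs in the denominator on both sides, so its vanishing makes both sides `0` and no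
  -- hypothesis on it is needed.
  rcases eq_or_ne S 0 with hS | hS
  · simp [hS]
  field_simp

theorem qPoch_ne_zero {q z : ℝ} {n : ℕ} (h : ∀ i < n, z * q ^ i ≠ 1) : qPoch z q n ≠ 0 :=
  prod_ne_zero_iff.2 fun i hi => sub_ne_zero.2 (h i (mem_range.1 hi)).symm

theorem qPoch_self_ne_zero {q : ℝ} (hq0 : 0 < q) (hq1 : q < 1) (n : ℕ) : qPoch q q n ≠ 0 :=
  qPoch_ne_zero fun i _ => by
    rw [← pow_succ']; exact (pow_lt_one₀ hq0.le hq1 (by omega)).ne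

theorem weightEven_eq_quadrature {q a c : ℝ} (hq0 : 0 < q) (hq1 : q < 1) (ha : a ≠ 0) (hc : c ≠ 0)
    (α : ℝ) {k s : ℕ} (hs : s ≤ k + 1)
    (H : Set.InjOn (node q a c) (Set.Iic (2 * (k + 1)))) :
    weightEven q a c α (k + 1) s = (1 - α) * ((uMid q a c (k + 1)
      * ∏ i ∈ range k, uCoef q a c α (k + 1) (i + 1)) /
        ((∏ r ∈ range (k + 1), (lattice q a s - lattice q c r))
          * ∏ r ∈ (range (k + 2)).erase s, (lattice q a s - lattice q a r))) := by
  have hq := hq0.ne'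
  have hqp : ∀ n, q ^ n ≠ 0 := fun n => pow_ne_zero n hq
  have g1 := qPoch_neg_zpow_mul_prod_erase hq (k + 1) s hs
  have g2 := qPoch_zpow_mul_prod hq (div_ne_zero ha hc) (k + 1) s
  have g3 : qPoch (a * c) q s * qPoch (a * c * q ^ s) q (k + 1) =
      qPoch (a * c) q (k + 1) * qPoch (a * c * q ^ (k + 1)) q s := by
    rw [← qPoch_add, ← qPoch_add, add_comm]
  rw [prod_lattice_sub hq ha hc, prod_erase_lattice_sub hq ha s (k + 1) hs]
  rw [div_mul_eq_mul_div, div_mul_eq_mul_div, inv_div] at g2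
  have hK := KConst_eq_prod hq0 hq1 ha hc α k
  have hT := prod_pow_mul_prod_pow_succ q (k + 1)
  have hT1 : ∏ i ∈ range (k + 1), q ^ i ≠ 0 := prod_ne_zero_iff.2 fun i _ => hqp i
  have hT2 : ∏ i ∈ range (k + 1), q ^ (i + 1) ≠ 0 := prod_ne_zero_iff.2 fun i _ => hqp _
  have n2 : qPoch (c / a) q (k + 1) ≠ 0 := qPoch_ne_zero fun i hi h =>
    mul_pow_ne_left_of_injOn hq0 ha hc H hi (by field_simp at h; linarith)
  have n3 : qPoch (a * c) q (k + 1) ≠ 0 := qPoch_ne_zero fun i hi =>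
    mul_pow_ne_one_of_injOn hq0 ha hc H (by omega)
  have n5 : qPoch (a * q / c) q s ≠ 0 := qPoch_ne_zero fun i hi h =>
    mul_pow_ne_right_of_injOn hq0 ha hc (by omega) H (show i + 1 ≤ k + 1 by omega) (by
      rw [pow_succ]; field_simp at h; linarith)
  have n6 : qPoch (a * c * q ^ (k + 1)) q s ≠ 0 := qPoch_ne_zero fun i hi => by
    rw [mul_assoc, ← pow_add]
    exact mul_pow_ne_one_of_injOn hq0 ha hc H (by omega)
  have hac : a / c ≠ 0 := div_ne_zero ha hc
  -- An `a`-point has `j` other `a`-points and `j` `c`-points to be compared with; each difference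
  -- contributes one factor `2aq^s` to `W` or `V`.
  have main := weight_cancel (S := selfProd q (a ^ 2) (k + 1) s)
    (W := (2 * a * q ^ s) ^ (k + 1)) (V := (2 * a * q ^ s) ^ (k + 1))
    (K := KConst q a c (k + 1) * a ^ (k + 1) * c ^ (k + 1) * q ^ (2 * (k + 1) * s))
    (h := uMid q a c (k + 1) * ∏ i ∈ range k, uCoef q a c α (k + 1) (i + 1)) g1 g2 g3
    (qPoch_self_ne_zero hq0 hq1 _) n2 n3 (qPoch_self_ne_zero hq0 hq1 _) n5 n6
    (div_ne_zero (pow_ne_zero _ (by norm_num)) hT2)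
    (div_ne_zero (pow_ne_zero _ (neg_ne_zero.2 hac)) hT1)
    (pow_ne_zero _ (mul_ne_zero (mul_ne_zero two_ne_zero ha) (hqp s)))
    (pow_ne_zero _ (mul_ne_zero (mul_ne_zero two_ne_zero ha) (hqp s)))
    (by
      rw [hK, ← hT]
      rw [neg_pow (a / c), div_pow]
      have e : ((-1 : ℝ) ^ (k + 1)) * (-1) ^ (k + 1) = 1 := by
        rw [← mul_pow]; norm_num
      have e4 : (4 : ℝ) ^ (k + 1) = 2 ^ (k + 1) * 2 ^ (k + 1) := by
        rw [← mul_pow]; norm_num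
      have eq : q ^ (2 * (k + 1) * s) = (q ^ s) ^ (k + 1) * (q ^ s) ^ (k + 1) := by
        rw [← pow_mul, ← pow_add]; congr 1; ring
      rw [e4, eq, mul_pow, mul_pow]
      generalize uMid q a c (k + 1) * ∏ i ∈ range k, uCoef q a c α (k + 1) (i + 1) = h
      generalize ∏ i ∈ range (k + 1), q ^ i = T at *
      generalize ∏ i ∈ range (k + 1), q ^ (i + 1) = T' at *
      generalize (-1 : ℝ) ^ (k + 1) = σ at *
      field_simp
      linear_combination h * e)
  rw [← main, weightEven, ← mul_div_assoc]
  congr 1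
  ring

theorem weightOdd_eq_quadrature {q a c : ℝ} (hq0 : 0 < q) (hq1 : q < 1) (ha : a ≠ 0) (hc : c ≠ 0)
    (α : ℝ) {k s : ℕ} (hs : s ≤ k)
    (H : Set.InjOn (node q a c) (Set.Iic (2 * (k + 1)))) :
    weightOdd q a c α (k + 1) s = α * (-(uMid q a c (k + 1)
      * ∏ i ∈ range k, uCoef q a c α (k + 1) (i + 1)) /
        ((∏ r ∈ range (k + 2), (lattice q c s - lattice q a r))
          * ∏ r ∈ (range (k + 1)).erase s, (lattice q c s - lattice q c r))) := by
  have hq := hq0.ne'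
  have hqp : ∀ n, q ^ n ≠ 0 := fun n => pow_ne_zero n hq
  have g1 := qPoch_neg_zpow_mul_prod_erase hq k s hs
  have g2 := qPoch_zpow_mul_prod hq (div_ne_zero hc ha) (k + 2) s
  have g3 : qPoch (a * c) q s * qPoch (a * c * q ^ s) q (k + 2) =
      qPoch (a * c) q (k + 2) * qPoch (a * c * q ^ (k + 2)) q s := by
    rw [← qPoch_add, ← qPoch_add, add_comm]
  rw [prod_lattice_sub hq hc ha, prod_erase_lattice_sub hq hc s k hs, mul_comm c a]
  rw [div_mul_eq_mul_div, div_mul_eq_mul_div, inv_div] at g2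
  have hK := KConst_eq_prod hq0 hq1 ha hc α k
  have hT := prod_pow_mul_prod_pow_succ q (k + 1)
  have hT1 : ∏ i ∈ range (k + 1), q ^ i ≠ 0 := prod_ne_zero_iff.2 fun i _ => hqp i
  have hT2 : ∏ i ∈ range (k + 1), q ^ (i + 1) ≠ 0 := prod_ne_zero_iff.2 fun i _ => hqp _
  -- Dropping or adding the index `0` brings both products to the shapes whose product is
  -- `q^{(k+1)²}`.
  have hS1 : ∏ i ∈ range (k + 2), q ^ i = ∏ i ∈ range (k + 1), q ^ (i + 1) := by
    rw [prod_range_succ', pow_zero, mul_one]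
  have hS2 : ∏ i ∈ range k, q ^ (i + 1) = ∏ i ∈ range (k + 1), q ^ i := by
    rw [prod_range_succ', pow_zero, mul_one]
  rw [hS1] at g2
  rw [hS2] at g1
  have n2 : qPoch (a / c) q (k + 2) ≠ 0 := qPoch_ne_zero fun i hi h =>
    mul_pow_ne_right_of_injOn hq0 ha hc (by omega) H (show i ≤ k + 1 by omega)
      (by field_simp at h; linarith)
  have n3 : qPoch (a * c) q (k + 2) ≠ 0 := qPoch_ne_zero fun i hi =>
    mul_pow_ne_one_of_injOn hq0 ha hc H (by omega)
  have n5 : qPoch (c * q / a) q s ≠ 0 := qPoch_ne_zero fun i hi h =>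
    mul_pow_ne_left_of_injOn hq0 ha hc H (show i + 1 < k + 1 by omega) (by
      rw [pow_succ]; field_simp at h; linarith)
  have n6 : qPoch (a * c * q ^ (k + 2)) q s ≠ 0 := qPoch_ne_zero fun i hi => by
    rw [mul_assoc, ← pow_add]
    exact mul_pow_ne_one_of_injOn hq0 ha hc H (by omega)
  have hca : c / a ≠ 0 := div_ne_zero hc ha
  -- A `c`-point has `k` other `c`-points and `k + 2` `a`-points, hence the unequal exponents.
  have main := weight_cancel (S := selfProd q (c ^ 2) k s)
    (W := (2 * c * q ^ s) ^ k) (V := (2 * c * q ^ s) ^ (k + 2))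
    (K := KConst q a c (k + 1) * a ^ (k + 1 + 1) * c ^ k * q ^ (2 * (k + 1) * s))
    (h := uMid q a c (k + 1) * ∏ i ∈ range k, uCoef q a c α (k + 1) (i + 1)) g1 g2 g3
    (qPoch_self_ne_zero hq0 hq1 _) n2 n3 (qPoch_self_ne_zero hq0 hq1 _) n5 n6
    (div_ne_zero (pow_ne_zero _ (by norm_num)) hT1)
    (div_ne_zero (pow_ne_zero _ (neg_ne_zero.2 hca)) hT2)
    (pow_ne_zero _ (mul_ne_zero (mul_ne_zero two_ne_zero hc) (hqp s)))
    (pow_ne_zero _ (mul_ne_zero (mul_ne_zero two_ne_zero hc) (hqp s)))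
    (by
      rw [hK, ← hT]
      rw [neg_pow (c / a), div_pow]
      have e : ((-1 : ℝ) ^ (k + 2)) * (-1) ^ k = 1 := by
        rw [pow_add, mul_right_comm, ← mul_pow]; norm_num
      have e4 : (4 : ℝ) ^ (k + 1) = 2 ^ (k + 2) * 2 ^ k := by
        rw [← pow_add, show k + 2 + k = 2 * (k + 1) by ring, pow_mul]; norm_num
      have eq : q ^ (2 * (k + 1) * s) = (q ^ s) ^ (k + 2) * (q ^ s) ^ k := by
        rw [← pow_mul, ← pow_mul, ← pow_add]; congr 1; ring
      rw [e4, eq, mul_pow, mul_pow, mul_pow, mul_pow]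
      generalize uMid q a c (k + 1) * ∏ i ∈ range k, uCoef q a c α (k + 1) (i + 1) = h
      generalize ∏ i ∈ range (k + 1), q ^ i = T at *
      generalize ∏ i ∈ range (k + 1), q ^ (i + 1) = T' at *
      generalize (-1 : ℝ) ^ (k + 2) = σ at *
      generalize (-1 : ℝ) ^ k = σ' at *
      field_simp
      linear_combination h * e)
  rw [neg_div, ← main, weightOdd, mul_neg, ← mul_div_assoc, ← neg_div, Nat.add_sub_cancel,
    show (1 - ((k + 1 : ℕ) : ℤ)) = -(k : ℤ) by push_cast; ring,
    show (-((k + 1 : ℕ) : ℤ)) = 1 - ((k + 2 : ℕ) : ℤ) by push_cast; ring]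
  congr 1
  ring

/-! ### Orthogonality and positivity -/

theorem eval_prod_X_sub_C (y : ℕ → ℝ) (s : Finset ℕ) (x : ℝ) :
    (∏ i ∈ s, (X - C (y i))).eval x = ∏ i ∈ s, (x - y i) := by
  simp [eval_prod]

theorem eval_derivative_prod_X_sub_C (y : ℕ → ℝ) {s : Finset ℕ} {i : ℕ} (hi : i ∈ s) :
    (derivative (∏ i ∈ s, (X - C (y i)))).eval (y i) = ∏ r ∈ s.erase i, (y i - y r) := by
  rw [← Lagrange.nodal_eq, Lagrange.eval_nodal_derivative_eval_node_eq hi, Lagrange.eval_nodal]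

theorem uCoef_of_lt (q a c α β : ℝ) {j n : ℕ} (hn : n < j) :
    uCoef q a c α j n = uCoef q a c β j n := by
  rw [uCoef, uCoef, if_neg (by omega), if_neg (by omega), if_neg (by omega), if_neg (by omega)]

theorem uCoef_self (q a c α : ℝ) (j : ℕ) : uCoef q a c α j j = (1 - α) * uMid q a c j := by
  rw [uCoef, if_pos rfl]

theorem uCoef_succ_self (q a c α : ℝ) (j : ℕ) : uCoef q a c α j (j + 1) = α * uMid q a c j := by
  rw [uCoef, if_neg (by omega), if_pos rfl]

/-- The numerator of the Gauss weights at `α = 0`: there `u_j = μ`, while the earlier coefficients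
agree for all `α`. -/
theorem prod_uCoef_alpha_zero (q a c α : ℝ) (k : ℕ) :
    ∏ i ∈ Icc 1 (k + 1), uCoef q a c 0 (k + 1) i =
      uMid q a c (k + 1) * ∏ i ∈ range k, uCoef q a c α (k + 1) (i + 1) := by
  rw [prod_Icc_succ_top (by omega), uCoef_self, sub_zero, one_mul, mul_comm]
  congr 1
  rw [range_eq_Ico, prod_Ico_add' (fun i => uCoef q a c α (k + 1) i) 0 k 1, zero_add]
  exact prod_congr (by ext; simp) fun i hi =>
    uCoef_of_lt _ _ _ _ _ (by rw [mem_Ico] at hi; omega)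

theorem weight_functional {q a c : ℝ} (hq0 : 0 < q) (hq1 : q < 1) (ha : a ≠ 0) (hc : c ≠ 0)
    (α : ℝ) (k : ℕ) (H : Set.InjOn (node q a c) (Set.Iic (2 * (k + 1)))) :
    (∀ n ≤ 2 * (k + 1), ∑ s ∈ range (2 * (k + 1) + 1), weight q a c α (k + 1) s
      * (recPoly (bCoef q a c (k + 1)) (uCoef q a c α (k + 1)) n).eval (node q a c s) =
        if n = 0 then 1 else 0) ∧
    ∑ s ∈ range (k + 2), weight q a c α (k + 1) (2 * s) = 1 - α := by
  have hu : ∀ n, 1 ≤ n → n ≤ k + 1 → uCoef q a c 0 (k + 1) n ≠ 0 := by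
    intro n h1 h2
    rcases Nat.lt_or_eq_of_le h2 with h | h
    · exact uCoef_ne_zero_of_injOn hq0 hq1 ha hc 0 h1 h H
    · rw [h, uCoef_self, sub_zero, one_mul]
      exact uMid_ne_zero_of_injOn hq0 hq1 ha hc (by omega) H
  have hy := injOn_lattice_even H
  have hz := injOn_lattice_odd H
  have hPy := recPoly_alpha_zero hq0 hq1 ha hc (k + 1)
  have hPz := recPoly_half hq0 hq1 ha hc 0 (k + 1) (by omega)
  have he : ∀ s ∈ range (k + 2), weight q a c α (k + 1) (2 * s) = (1 - α) *
      ((∏ i ∈ Icc 1 (k + 1), uCoef q a c 0 (k + 1) i) /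
        ((recPoly (bCoef q a c (k + 1)) (uCoef q a c 0 (k + 1)) (k + 1)).eval (lattice q a s)
          * ∏ r ∈ (range (k + 2)).erase s, (lattice q a s - lattice q a r))) := by
    intro s hs
    rw [mem_range] at hs
    rw [weight_even, weightEven_eq_quadrature hq0 hq1 ha hc α (by omega) H,
      ← prod_uCoef_alpha_zero, hPz, eval_prod_X_sub_C]
  have ho : ∀ s ∈ range (k + 1), weight q a c α (k + 1) (2 * s + 1) = α *
      (-(∏ i ∈ Icc 1 (k + 1), uCoef q a c 0 (k + 1) i) /
        ((recPoly (bCoef q a c (k + 1)) (uCoef q a c 0 (k + 1)) (k + 2)).eval (lattice q c s)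
          * ∏ r ∈ (range (k + 1)).erase s, (lattice q c s - lattice q c r))) := by
    intro s hs
    rw [mem_range] at hs
    rw [weight_odd, weightOdd_eq_quadrature hq0 hq1 ha hc α (by omega) H,
      ← prod_uCoef_alpha_zero, hPy, eval_prod_X_sub_C]
  constructor
  · intro n hn
    rw [← recPoly_mixture (b := bCoef q a c (k + 1)) (v := uCoef q a c α (k + 1)) (α := α)
      (fun n _ h => uCoef_of_lt q a c α 0 h)
      (by rw [uCoef_self, uCoef_self]; ring) hu hy hz hPy hPz hn, sum_range_two_mul_add_one]
    congr 1
    · exact sum_congr rfl fun s hs => by rw [he s hs, node_even]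
    · exact sum_congr rfl fun s hs => by rw [ho s hs, node_odd]
  · have h := recPoly_quadrature hu hy hPy (Nat.zero_le _) 1 (by simp)
    simp only [recPoly_zero, eval_one, mul_one, coeff_one_zero] at h
    rw [sum_congr rfl he, ← mul_sum, h]
    simp

theorem weight_odd_sum {q a c : ℝ} (hq0 : 0 < q) (hq1 : q < 1) (ha : a ≠ 0) (hc : c ≠ 0)
    (α : ℝ) (k : ℕ) (H : Set.InjOn (node q a c) (Set.Iic (2 * (k + 1)))) :
    ∑ s ∈ range (k + 1), weight q a c α (k + 1) (2 * s + 1) = α := by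
  obtain ⟨h1, h2⟩ := weight_functional hq0 hq1 ha hc α k H
  have h := h1 0 (Nat.zero_le _)
  simp only [recPoly_zero, eval_one, mul_one, if_true] at h
  rw [sum_range_two_mul_add_one, h2] at h
  linarith

/-- `μ = u_j + u_{j+1}` is positive, hence so are both shares. -/
theorem uMid_pos_of_uCoef_pos {q a c α : ℝ} {k : ℕ}
    (hu : ∀ n, 1 ≤ n → n ≤ 2 * (k + 1) → 0 < uCoef q a c α (k + 1) n) :
    0 < uMid q a c (k + 1) ∧ 0 < α ∧ 0 < 1 - α := by
  have h1 := hu (k + 1) (by omega) (by omega)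
  have h2 := hu (k + 1 + 1) (by omega) (by omega)
  rw [uCoef_self] at h1
  rw [uCoef_succ_self] at h2
  have hm : 0 < uMid q a c (k + 1) := by linarith
  exact ⟨hm, pos_of_mul_pos_left h2 hm.le, pos_of_mul_pos_left h1 hm.le⟩

/-- Two equal nodes would give a double zero of `P_{2j+1}`, where the Wronskian with `P_{2j}`
vanishes. -/
theorem node_injOn_of_uCoef_pos {q a c : ℝ} (hq0 : 0 < q) (hq1 : q < 1) (ha : a ≠ 0) (hc : c ≠ 0)
    {α : ℝ} {j : ℕ} (hj : 1 ≤ j) (hu : ∀ n, 1 ≤ n → n ≤ 2 * j → 0 < uCoef q a c α j n) :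
    Set.InjOn (node q a c) (Set.Iic (2 * j)) := by
  intro s hs r hr h
  by_contra hne
  rw [Set.mem_Iic] at hs hr
  have hw := recPoly_wronskian_pos (b := bCoef q a c j) hu (node q a c s)
  have hs' : s ∈ range (2 * j + 1) := mem_range.2 (by omega)
  have hr' : r ∈ (range (2 * j + 1)).erase s := mem_erase.2 ⟨Ne.symm hne, mem_range.2 (by omega)⟩
  rw [recPoly_full_node hq0 hq1 ha hc α j hj, eval_derivative_prod_X_sub_C _ hs',
    eval_prod_X_sub_C, prod_eq_zero hr' (sub_eq_zero.2 h), prod_eq_zero hs' (sub_self _)] at hw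
  simp at hw

theorem weight_pos {q a c : ℝ} (hq0 : 0 < q) (hq1 : q < 1) (ha : a ≠ 0) (hc : c ≠ 0)
    {α : ℝ} {k : ℕ} (hu : ∀ n, 1 ≤ n → n ≤ 2 * (k + 1) → 0 < uCoef q a c α (k + 1) n)
    {s : ℕ} (hs : s ≤ 2 * (k + 1)) : 0 < weight q a c α (k + 1) s := by
  have H := node_injOn_of_uCoef_pos hq0 hq1 ha hc (by omega) hu
  obtain ⟨hm, hα, hα'⟩ := uMid_pos_of_uCoef_pos hu
  have hu0 : ∀ n, 1 ≤ n → n ≤ k + 1 → 0 < uCoef q a c 0 (k + 1) n := by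
    intro n h1 h2
    rcases Nat.lt_or_eq_of_le h2 with h | h
    · rw [uCoef_of_lt q a c 0 α h]; exact hu n h1 (by omega)
    · rw [h, uCoef_self, sub_zero, one_mul]; exact hm
  have hh : 0 < uMid q a c (k + 1) * ∏ i ∈ range k, uCoef q a c α (k + 1) (i + 1) :=
    mul_pos hm (prod_pos fun i hi => by
      rw [mem_range] at hi; exact hu _ (by omega) (by omega))
  -- For the chain at `α = 0`: at an `a`-point this says `P_{j+1}' P_j > 0`, at a `c`-point `P_j'
  -- P_{j+1} < 0`. These are the denominators of the even and odd weights, and the odd numerator is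
  -- negative.
  have hw := recPoly_wronskian_pos (b := bCoef q a c (k + 1)) hu0
  rw [recPoly_alpha_zero hq0 hq1 ha hc (k + 1),
    recPoly_half hq0 hq1 ha hc 0 (k + 1) (by omega)] at hw
  rcases Nat.even_or_odd' s with ⟨i, rfl | rfl⟩
  · have hi : i ∈ range (k + 1 + 1) := mem_range.2 (by omega)
    have := hw (lattice q a i)
    rw [eval_derivative_prod_X_sub_C _ hi, eval_prod_X_sub_C, eval_prod_X_sub_C,
      prod_eq_zero hi (sub_self _), mul_zero, sub_zero, mul_comm] at this
    rw [weight_even, weightEven_eq_quadrature hq0 hq1 ha hc α (by omega) H]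
    exact mul_pos hα' (div_pos hh this)
  · have hi : i ∈ range (k + 1) := mem_range.2 (by omega)
    have := hw (lattice q c i)
    rw [eval_derivative_prod_X_sub_C (lattice q c) hi, eval_prod_X_sub_C, eval_prod_X_sub_C,
      prod_eq_zero hi (sub_self _), mul_zero, zero_sub, mul_comm] at this
    rw [weight_odd, weightOdd_eq_quadrature hq0 hq1 ha hc α (by omega) H]
    exact mul_pos hα (div_pos_of_neg_of_neg (neg_neg_of_pos hh) (neg_pos.1 this))

end QParaRacah

theorem mainTheorem2 (q a c α : ℝ) (j : ℕ) (hq0 : 0 < q) (hq1 : q < 1) (ha : a ≠ 0) (hc : c ≠ 0)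
    (hj : 1 ≤ j) :
    -- the coefficients of the recurrence are the limits of those of Askey-Wilson
    (∀ e₁ e₂ : ℝ, e₁ + e₂ ≠ 0 → e₁ / (e₁ + e₂) = α →
      (∀ n : ℕ, n ≤ 2 * j →
        Tendsto (fun t : ℝ =>
            (a + a⁻¹ - QParaRacah.awA q a (QParaRacah.bPar q a e₁ j t) c
                (QParaRacah.dPar q c e₂ j t) n
              - QParaRacah.awC q a (QParaRacah.bPar q a e₁ j t) c
                (QParaRacah.dPar q c e₂ j t) n) / 2)
          (𝓝[≠] 0) (𝓝 (QParaRacah.bCoef q a c j n))) ∧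
      (∀ n : ℕ, 1 ≤ n → n ≤ 2 * j →
        Tendsto (fun t : ℝ =>
            QParaRacah.awA q a (QParaRacah.bPar q a e₁ j t) c
                (QParaRacah.dPar q c e₂ j t) (n - 1)
              * QParaRacah.awC q a (QParaRacah.bPar q a e₁ j t) c
                (QParaRacah.dPar q c e₂ j t) n / 4)
          (𝓝[≠] 0) (𝓝 (QParaRacah.uCoef q a c α j n)))) ∧
    -- the characteristic polynomial
    (∃ κ : ℝ, κ ≠ 0 ∧ ∀ θ : ℂ,
      Polynomial.aeval (Complex.cos θ) (QParaRacah.R q a c α j (2 * j + 1)) =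
        (κ : ℂ) *
          (QParaRacah.qPoch ((a : ℂ) * Complex.exp (Complex.I * θ)) (q : ℂ) (j + 1)
            * QParaRacah.qPoch ((a : ℂ) * Complex.exp (-(Complex.I * θ))) (q : ℂ) (j + 1)
            * (QParaRacah.qPoch ((c : ℂ) * Complex.exp (Complex.I * θ)) (q : ℂ) j
              * QParaRacah.qPoch ((c : ℂ) * Complex.exp (-(Complex.I * θ))) (q : ℂ) j))) ∧
    -- its zeros are the points of the bi-lattice
    (∀ x : ℝ, (QParaRacah.R q a c α j (2 * j + 1)).IsRoot x ↔
      ∃ s : ℕ, s ≤ 2 * j ∧ x = QParaRacah.node q a c s) ∧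
    -- orthogonality and partial sums of the weights, when the points are distinct
    (Set.InjOn (QParaRacah.node q a c) (Set.Iic (2 * j)) →
      (∀ n m : ℕ, n ≤ 2 * j → m ≤ 2 * j →
        ∑ s ∈ Finset.range (2 * j + 1), QParaRacah.weight q a c α j s
            * (QParaRacah.R q a c α j n).eval (QParaRacah.node q a c s)
            * (QParaRacah.R q a c α j m).eval (QParaRacah.node q a c s) =
          if n = m then ∏ k ∈ Finset.Icc 1 n, QParaRacah.uCoef q a c α j k else 0) ∧
      ∑ s ∈ Finset.range (j + 1), QParaRacah.weight q a c α j (2 * s) = 1 - α ∧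
      ∑ s ∈ Finset.range j, QParaRacah.weight q a c α j (2 * s + 1) = α) ∧
    -- under positivity of the coefficients the points are distinct and the weights positive
    ((∀ n : ℕ, 1 ≤ n → n ≤ 2 * j → 0 < QParaRacah.uCoef q a c α j n) →
      Set.InjOn (QParaRacah.node q a c) (Set.Iic (2 * j)) ∧
      ∀ s : ℕ, s ≤ 2 * j → 0 < QParaRacah.weight q a c α j s) := by
  refine ⟨fun e₁ e₂ he hα => ⟨fun n _ => ?_, fun n hn _ => ?_⟩, ?_, fun x => ?_, fun H => ?_,
    fun hu => ?_⟩
  · exact QParaRacah.tendsto_awDiag hq0 hq1 ha hc he hα j n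
  · exact QParaRacah.tendsto_awOff hq0 hq1 ha hc he hα j n hn
  · rw [QParaRacah.R_eq_recPoly]
    exact QParaRacah.recPoly_full_characteristic hq0 hq1 ha hc α j hj
  · rw [QParaRacah.R_eq_recPoly, QParaRacah.recPoly_full_node hq0 hq1 ha hc α j hj,
      Polynomial.IsRoot.def, QParaRacah.eval_prod_X_sub_C, Finset.prod_eq_zero_iff]
    simp only [Finset.mem_range, Nat.lt_succ_iff, sub_eq_zero]
  · obtain ⟨k, rfl⟩ : ∃ k, j = k + 1 := ⟨j - 1, by omega⟩
    obtain ⟨h1, h2⟩ := QParaRacah.weight_functional hq0 hq1 ha hc α k H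
    refine ⟨fun n m hn hm => ?_, h2, QParaRacah.weight_odd_sum hq0 hq1 ha hc α k H⟩
    rw [QParaRacah.R_eq_recPoly, QParaRacah.R_eq_recPoly]
    refine QParaRacah.recPoly_orthogonal (fun s hs => ?_) h1 m hm n hn
    rw [QParaRacah.recPoly_full_node hq0 hq1 ha hc α _ hj, QParaRacah.eval_prod_X_sub_C]
    exact Finset.prod_eq_zero hs (sub_self _)
  · obtain ⟨k, rfl⟩ : ∃ k, j = k + 1 := ⟨j - 1, by omega⟩
    exact ⟨QParaRacah.node_injOn_of_uCoef_pos hq0 hq1 ha hc hj hu,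
      fun s hs => QParaRacah.weight_pos hq0 hq1 ha hc hu hs⟩
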